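/- Let $\alpha<\gamma<\beta$ be real numbers, let $a\in C^1[\alpha,\beta]$ be a strictly positive function and let $V\in L^\infty[\alpha,\beta]$ be real-valued. For a subinterval $[c,d]\subseteq[\alpha,\beta]$ with $c<d$, the Neumann Sturm--Liouville operator on $(c,d)$ is the operator $$f\mapsto -(a f')'+Vf$$ in the complex Hilbert space $L^2(c,d)$ whose domain consists of all $f\in C^1[c,d]$ such that $f'$ is absolutely continuous, $-(af')'+Vf\in L^2(c,d)$ and $f'(c)=f'(d)=0$. Let $H_1$, $H_2$ and $H$ be the Neumann Sturm--Liouville operators on $(\alpha,\gamma)$, $(\gamma,\beta)$ and $(\alpha,\beta)$. Then the eigenvalues of each of $H_1$, $H_2$, $H$ are real and can be written as an infinite sequence, indexed by $i=0,1,2,\dots$, in increasing order and repeated according to their (finite) multiplicities: $\{\lambda_i\}$, $\{\mu_i\}$ and $\{\nu_i\}$ respectively. Moreover $\{\lambda_i\}$ and $\{\mu_i\}$ can be merged, keeping repetitions, into a single sequence $\{\sigma_i\}_{i\ge0}$ in increasing order. For all $i\geq 0$ one has $$\sigma_i\le\nu_i\le\sigma_{i+1}.$$ Both inequalities are strict,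 $\sigma_i<\nu_i<\sigma_{i+1}$, unless the derivative of the eigenfunction of $H$ associated with the eigenvalue $\nu_i$ vanishes at $\gamma$; more precisely, they are strict whenever some eigenfunction $f$ of $H$ with eigenvalue $\nu_i$ satisfies $f'(\gamma)\neq0$. -/

import Mathlib

open MeasureTheory Set

namespace NeumannDecoupling

/-- The complex Hilbert space `L²(α, β)`. -/
abbrev L2 (α β : ℝ) : Type := Lp ℂ 2 (volume.restrict (Ioo α β))

/-- Functions `u` that are differentiable on `[α, β]` (one-sidedly at the end points), whose
derivative is absolutely continuous on `[α, β]`, and which satisfy the Neumann boundary conditions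
`u'(α) = u'(β) = 0`. -/
structure IsNeumannFunction (α β : ℝ) (u : ℝ → ℂ) : Prop where
  differentiableOn : DifferentiableOn ℝ u (Icc α β)
  absolutelyContinuous : AbsolutelyContinuousOnInterval (derivWithin u (Icc α β)) α β
  deriv_left : derivWithin u (Icc α β) α = 0
  deriv_right : derivWithin u (Icc α β) β = 0

/-- `h = -(a u')' + V u` almost everywhere on `(α, β)`, including the existence of the
outer derivative almost everywhere. -/
def IsSturmLiouvilleImage (a V : ℝ → ℝ) (α β : ℝ) (u h : ℝ → ℂ) : Prop :=
  ∀ᵐ x ∂(volume.restrict (Ioo α β)),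
    HasDerivAt (fun y => (a y : ℂ) * derivWithin u (Icc α β) y) ((V x : ℂ) * u x - h x) x

theorem derivWithin_Icc_add {α β : ℝ} {u v : ℝ → ℂ} (hu : DifferentiableOn ℝ u (Icc α β))
    (hv : DifferentiableOn ℝ v (Icc α β)) :
    derivWithin (u + v) (Icc α β) = derivWithin u (Icc α β) + derivWithin v (Icc α β) := by
  funext x
  by_cases hx : x ∈ Icc α β
  · exact derivWithin_add (hu x hx) (hv x hx)
  · have hx' : x ∉ closure (Icc α β) := by rwa [isClosed_Icc.closure_eq]
    simp [derivWithin_zero_of_notMem_closure hx']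

/-- The graph of the Neumann operator `H f = -(a f')' + V f` in `L²(α, β)`: the pairs `(f, h)` of
elements of `L²(α, β)` such that `f` is represented by a function `u` with absolutely continuous
derivative and Neumann boundary conditions, and `h = -(a u')' + V u`. -/
def neumannGraph (a V : ℝ → ℝ) (α β : ℝ) : Submodule ℂ (L2 α β × L2 α β) where
  carrier := {p | ∃ u : ℝ → ℂ, IsNeumannFunction α β u ∧
    (p.1 : ℝ → ℂ) =ᵐ[volume.restrict (Ioo α β)] u ∧ IsSturmLiouvilleImage a V α β u p.2}
  zero_mem' := by
    have h0 : derivWithin (0 : ℝ → ℂ) (Icc α β) = 0 := by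
      funext x; simp
    refine ⟨0, ⟨differentiableOn_const 0, ?_, by simp [h0], by simp [h0]⟩,
      Lp.coeFn_zero _ _ _, ?_⟩
    · rw [h0]
      simp only [AbsolutelyContinuousOnInterval, Pi.zero_apply, dist_self, Finset.sum_const_zero]
      exact tendsto_const_nhds
    · filter_upwards [Lp.coeFn_zero ℂ 2 (volume.restrict (Ioo α β))] with x hx
      have hx' : ((0 : L2 α β × L2 α β).2 : ℝ → ℂ) x = 0 := hx
      simp only [h0, hx', Pi.zero_apply, mul_zero, sub_zero]
      exact hasDerivAt_const x 0
  add_mem' := by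
    rintro ⟨f, h⟩ ⟨g, k⟩ ⟨u, hu, hfu, hh⟩ ⟨v, hv, hgv, hk⟩
    have hd := derivWithin_Icc_add hu.differentiableOn hv.differentiableOn
    refine ⟨u + v, ⟨hu.differentiableOn.add hv.differentiableOn, ?_, ?_, ?_⟩, ?_, ?_⟩
    · rw [hd]
      exact hu.absolutelyContinuous.add hv.absolutelyContinuous
    · simp [hd, hu.deriv_left, hv.deriv_left]
    · simp [hd, hu.deriv_right, hv.deriv_right]
    · exact (Lp.coeFn_add f g).trans (hfu.add hgv)
    · filter_upwards [hh, hk, Lp.coeFn_add h k] with x h1 h2 h3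
      have h3' : (((f, h) + (g, k) : L2 α β × L2 α β).2 : ℝ → ℂ) x = h x + k x := h3
      rw [hd, h3']
      refine ((h1.add h2).congr_deriv ?_).congr_of_eventuallyEq
        (Filter.Eventually.of_forall fun y => ?_)
      · simp only [Pi.add_apply]; ring
      · simp only [Pi.add_apply]; ring
  smul_mem' := by
    rintro c ⟨f, h⟩ ⟨u, hu, hfu, hh⟩
    have hd : derivWithin (c • u) (Icc α β) = c • derivWithin u (Icc α β) := by
      funext x
      by_cases hx : x ∈ Icc α β
      · exact derivWithin_const_smul c (hu.differentiableOn x hx)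
      · have hx' : x ∉ closure (Icc α β) := by rwa [isClosed_Icc.closure_eq]
        simp [derivWithin_zero_of_notMem_closure hx']
    refine ⟨c • u, ⟨hu.differentiableOn.const_smul c, ?_, ?_, ?_⟩, ?_, ?_⟩
    · rw [hd]
      exact hu.absolutelyContinuous.const_smul c
    · simp [hd, hu.deriv_left]
    · simp [hd, hu.deriv_right]
    · exact (Lp.coeFn_smul c f).trans (hfu.const_smul c)
    · filter_upwards [hh, Lp.coeFn_smul c h] with x h1 h3
      have h3' : ((c • (f, h) : L2 α β × L2 α β).2 : ℝ → ℂ) x = c * h x := h3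
      rw [hd, h3']
      refine ((h1.const_mul c).congr_deriv ?_).congr_of_eventuallyEq
        (Filter.Eventually.of_forall fun y => ?_)
      · simp only [Pi.smul_apply, smul_eq_mul]; ring
      · simp only [Pi.smul_apply, smul_eq_mul]; ring

/-- The Neumann Sturm–Liouville operator `H f = -(a f')' + V f` as an unbounded operator
in `L²(α, β)`. -/
noncomputable def neumannOperator (a V : ℝ → ℝ) (α β : ℝ) : L2 α β →ₗ.[ℂ] L2 α β :=
  (neumannGraph a V α β).toLinearPMap

/-- The graph is single-valued. -/
theorem neumannGraph_singleValued (a V : ℝ → ℝ) (α β : ℝ) :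
    ∀ p ∈ neumannGraph a V α β, p.1 = 0 → p.2 = 0 := by
  rintro ⟨f, h⟩ ⟨u, hu, hfu, hh⟩ (rfl : f = 0)
  have hu0 : (u : ℝ → ℂ) =ᵐ[volume.restrict (Ioo α β)] 0 := hfu.symm.trans (Lp.coeFn_zero _ _ _)
  have hz : EqOn u 0 (Ioo α β) :=
    Measure.eqOn_open_of_ae_eq hu0 isOpen_Ioo
      (hu.differentiableOn.continuousOn.mono Ioo_subset_Icc_self) continuousOn_const
  have hd : ∀ x ∈ Ioo α β, derivWithin u (Icc α β) x = 0 := by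
    intro x hx
    rw [derivWithin_of_mem_nhds (Icc_mem_nhds hx.1 hx.2)]
    have h1 : u =ᶠ[nhds x] fun _ => (0 : ℂ) := by
      filter_upwards [isOpen_Ioo.mem_nhds hx] with y hy using hz hy
    rw [h1.deriv_eq, deriv_const]
  refine (Lp.eq_zero_iff_ae_eq_zero).2 ?_
  filter_upwards [hh, ae_restrict_mem measurableSet_Ioo] with x hx hxm
  have h2 : (fun y => (a y : ℂ) * derivWithin u (Icc α β) y) =ᶠ[nhds x] fun _ => (0 : ℂ) := by
    filter_upwards [isOpen_Ioo.mem_nhds hxm] with y hy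
    rw [hd y hy, mul_zero]
  have h3 := hx.unique ((hasDerivAt_const x (0 : ℂ)).congr_of_eventuallyEq h2)
  have h4 : u x = 0 := hz hxm
  rw [h4, mul_zero, zero_sub, neg_eq_zero] at h3
  exact h3

theorem neumannOperator_graph (a V : ℝ → ℝ) (α β : ℝ) :
    (neumannOperator a V α β).graph = neumannGraph a V α β :=
  Submodule.toLinearPMap_graph_eq _ (neumannGraph_singleValued a V α β)

/-- The eigenspace `{f ∈ dom T | T f = z f}` of an unbounded operator. -/
def eigenspace {E : Type*} [AddCommGroup E] [Module ℂ E] (T : E →ₗ.[ℂ] E) (z : ℂ) :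
    Submodule ℂ E :=
  T.graph.comap (LinearMap.prod LinearMap.id (z • LinearMap.id))

theorem mem_eigenspace_iff {E : Type*} [AddCommGroup E] [Module ℂ E] (T : E →ₗ.[ℂ] E) (z : ℂ)
    (f : E) : f ∈ eigenspace T z ↔ ∃ hf : f ∈ T.domain, T ⟨f, hf⟩ = z • f := by
  simp [eigenspace, LinearPMap.mem_graph_iff]

/-- `ν` lists all eigenvalues of `T` in increasing order, each one repeated according to its
(finite) multiplicity; in particular all eigenvalues of `T` are real. -/
def IsEigenvalueList {E : Type} [AddCommGroup E] [Module ℂ E] (T : E →ₗ.[ℂ] E) (ν : ℕ → ℝ) :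
    Prop :=
  Monotone ν ∧ ∀ z : ℂ, FiniteDimensional ℂ (eigenspace T z) ∧
    {i : ℕ | (ν i : ℂ) = z}.encard = (Module.finrank ℂ (eigenspace T z) : ℕ∞)

/-- `σ` is the union with repetitions of the lists `l` and `m`, re-ordered in increasing order. -/
def IsMergedList (l m σ : ℕ → ℝ) : Prop :=
  Monotone σ ∧ ∃ e : ℕ ≃ ℕ ⊕ ℕ, ∀ i, σ i = Sum.elim l m (e i)

end NeumannDecoupling

open NeumannDecoupling

/-! Take a primitive `W` of `V`, put `A = 1 / a` and `q = a u' - W u`. The eigenvalue equation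
becomes a first-order system for `(u, q)` with continuous coefficients. In polar form `u = r sin θ`,
`q = r cos θ`, the angle satisfies a scalar equation whose right side is Lipschitz and `π`-periodic
in `θ` and nondecreasing in the spectral parameter. The Neumann condition at `x` reads `q + W u =
0`, that is, `θ x` equals `neumannAngle W x ∈ (0, π)` modulo `π`.

Start the angle at the Neumann angle of the left end. Its value at the right end is continuous and
strictly increasing in the parameter, stays positive, comes below every positive level and is
unbounded above. Hence it meets each `κ + j π`, `j ≥ 0`, exactly once. Eigenvalues are real and
simple, and these parameters are all of them (`exists_spectral_sequence`,
`IsRegularization.isEigenvalueList`).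

For interlacing, fix the parameter `ν i`. Compare the angle `θ` on `[α, β]` with the angle `η` on
`[γ, β]` that starts at the Neumann angle of `γ`. The branch of `θ γ` counts the eigenvalues of `H₁`
below `ν i`, and `η β` counts those of `H₂`. Since angles do not cross, the two counts add up to the
index `i` with an error of at most one (`exists_add_eq_forall_le`, `exists_add_eq_forall_ge`). If `ν
i` equals some `σ j`, then `θ γ` is a Neumann angle modulo `π`, so the derivative of the
eigenfunction vanishes at `γ`. -/

open Real Filter Topology

/-! ### Differential inequalities -/

/-- A scalar Grönwall-type lower bound. -/
theorem mul_exp_le_of_neg_mul_abs_le_deriv {w w' : ℝ → ℝ} {c d K : ℝ} (hK : 0 ≤ K)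
    (hw : ContinuousOn w (Icc c d)) (hw' : ∀ x ∈ Ico c d, HasDerivWithinAt w (w' x) (Ici x) x)
    (hc : 0 ≤ w c) (hbound : ∀ x ∈ Ico c d, -(K * |w x|) ≤ w' x) :
    ∀ x ∈ Icc c d, w c * exp (-(K * (x - c))) ≤ w x := by
  -- `-v` stays below the barrier `ε exp ((K + 1) (x - c))`: at a contact point its slope is at most
  -- `K` times the barrier, strictly less than the barrier's own slope. Then `ε` is made small.
  have weak : ∀ {v v' : ℝ → ℝ}, ContinuousOn v (Icc c d) →
      (∀ x ∈ Ico c d, HasDerivWithinAt v (v' x) (Ici x) x) → 0 ≤ v c →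
      (∀ x ∈ Ico c d, v x < 0 → K * v x ≤ v' x) → ∀ x ∈ Icc c d, 0 ≤ v x := by
    intro v v' hv hv' h0 hb x hx
    have key : ∀ ε : ℝ, 0 < ε → -v x ≤ ε * exp ((K + 1) * (x - c)) := by
      intro ε hε
      refine image_le_of_deriv_right_lt_deriv_boundary (f := fun y => -v y) (f' := fun y => -v' y)
        (B := fun y => ε * exp ((K + 1) * (y - c)))
        (B' := fun y => ε * (exp ((K + 1) * (y - c)) * ((K + 1) * 1)))
        hv.neg (fun y hy => (hv' y hy).neg) (by simp; linarith) (fun y => ?_) ?_ hx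
      · exact ((((hasDerivAt_id y).sub_const c).const_mul (K + 1)).exp).const_mul ε
      · intro y hy he
        have hp : 0 < ε * exp ((K + 1) * (y - c)) := by positivity
        have := hb y hy (by linarith)
        nlinarith
    by_contra hneg
    push Not at hneg
    have hE := exp_pos ((K + 1) * (x - c))
    have := key (-v x / 2 / exp ((K + 1) * (x - c))) (by apply div_pos; linarith; exact hE)
    rw [div_mul_cancel₀ _ hE.ne'] at this
    linarith
  have h1 : ∀ x ∈ Icc c d, 0 ≤ w x := by
    refine weak hw hw' hc fun x hx hneg => ?_
    have := hbound x hx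
    rw [abs_of_neg hneg] at this
    linarith
  intro x hx
  -- Now `w ≥ 0`, so the bound is `w' ≥ -K w` and the first pass applies to the difference with the
  -- exact exponential.
  have h2 := weak (v := fun y => w y - w c * exp (-(K * (y - c))))
    (v' := fun y => w' y - w c * (exp (-(K * (y - c))) * (-(K * 1))))
    (hw.sub (by fun_prop)) (fun y hy => (hw' y hy).sub ?_) (by simp) ?_ x hx
  · simpa using h2
  · exact ((((((hasDerivAt_id y).sub_const c).const_mul K).neg).exp).const_mul
      (w c)).hasDerivWithinAt
  · intro y hy hneg
    have h3 := hbound y hy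
    rw [abs_of_nonneg (h1 y (Ico_subset_Icc_self hy))] at h3
    nlinarith

/-! ### The Prüfer equation: existence, comparison, monotonicity in the parameter -/

/-- The right hand side of the Prüfer equation of the system
`u' = A (q + W u)`, `q' = - lam u - W A (q + W u)`. -/
noncomputable def pruferField (A W : ℝ → ℝ) (lam x θ : ℝ) : ℝ :=
  A x * (cos θ + W x * sin θ) ^ 2 + lam * sin θ ^ 2

/-- `θ` solves the Prüfer equation on `[c, d]`. -/
def IsPruferAngle (A W : ℝ → ℝ) (lam c d : ℝ) (θ : ℝ → ℝ) : Prop :=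
  ∀ x ∈ Icc c d, HasDerivWithinAt θ (pruferField A W lam x (θ x)) (Icc c d) x

theorem exists_bounds_of_continuous {A W : ℝ → ℝ} (hA : Continuous A) (hA0 : ∀ x, 0 < A x)
    (hW : Continuous W) (c d : ℝ) :
    ∃ E ε M : ℝ, 0 < ε ∧ 0 ≤ M ∧ ∀ x ∈ Icc c d, ε ≤ A x ∧ A x ≤ E ∧ |W x| ≤ M := by
  obtain ⟨E, hE⟩ := (isCompact_Icc (a := c) (b := d)).exists_bound_of_continuousOn hA.continuousOn
  obtain ⟨F, hF⟩ := (isCompact_Icc (a := c) (b := d)).exists_bound_of_continuousOn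
    (hA.inv₀ fun x => (hA0 x).ne').continuousOn
  obtain ⟨M, hM⟩ := (isCompact_Icc (a := c) (b := d)).exists_bound_of_continuousOn hW.continuousOn
  refine ⟨E, (max F 1)⁻¹, max M 0, by positivity, le_max_right _ _, fun x hx => ⟨?_, ?_, ?_⟩⟩
  · have h := hF x hx
    rw [Pi.inv_apply, norm_eq_abs, abs_of_pos (inv_pos.2 (hA0 x))] at h
    exact inv_le_of_inv_le₀ (hA0 x) (h.trans (le_max_left _ _))
  · exact (le_abs_self _).trans (hE x hx)
  · exact (hM x hx).trans (le_max_left _ _)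

theorem abs_pruferField_sub_le {A W : ℝ → ℝ} {E M x : ℝ} (hA0 : 0 ≤ A x) (hE : A x ≤ E)
    (hM : |W x| ≤ M) (lam θ η : ℝ) :
    |pruferField A W lam x θ - pruferField A W lam x η|
      ≤ (E * (2 * (1 + M) ^ 2) + 2 * |lam|) * |θ - η| := by
  have hs : |sin θ - sin η| ≤ |θ - η| := abs_sin_sub_sin_le θ η
  have hc : |cos θ - cos η| ≤ |θ - η| := abs_cos_sub_cos_le θ η
  have hM0 : 0 ≤ M := (abs_nonneg _).trans hM
  have hsum : ∀ t, |cos t + W x * sin t| ≤ 1 + M := fun t =>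
    calc |cos t + W x * sin t| ≤ |cos t| + |W x * sin t| := abs_add_le _ _
      _ = |cos t| + |W x| * |sin t| := by rw [abs_mul]
      _ ≤ 1 + M * 1 := by
        gcongr
        · exact abs_cos_le_one t
        · exact abs_sin_le_one t
      _ = 1 + M := by ring
  have h1 : |(cos θ + W x * sin θ) ^ 2 - (cos η + W x * sin η) ^ 2|
      ≤ 2 * (1 + M) ^ 2 * |θ - η| := by
    have e : (cos θ + W x * sin θ) ^ 2 - (cos η + W x * sin η) ^ 2
      = ((cos θ - cos η) + W x * (sin θ - sin η)) *
        ((cos θ + W x * sin θ) + (cos η + W x * sin η)) := by ring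
    rw [e, abs_mul]
    have h2 : |(cos θ - cos η) + W x * (sin θ - sin η)| ≤ (1 + M) * |θ - η| :=
      calc _ ≤ |cos θ - cos η| + |W x * (sin θ - sin η)| := abs_add_le _ _
        _ = |cos θ - cos η| + |W x| * |sin θ - sin η| := by rw [abs_mul]
        _ ≤ |θ - η| + M * |θ - η| := by gcongr
        _ = _ := by ring
    have h3 : |(cos θ + W x * sin θ) + (cos η + W x * sin η)| ≤ 2 * (1 + M) :=
      (abs_add_le _ _).trans (by linarith [hsum θ, hsum η])
    calc _ ≤ ((1 + M) * |θ - η|) * (2 * (1 + M)) := by gcongr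
      _ = _ := by ring
  have h4 : |sin θ ^ 2 - sin η ^ 2| ≤ 2 * |θ - η| := by
    have e : sin θ ^ 2 - sin η ^ 2 = (sin θ - sin η) * (sin θ + sin η) := by ring
    rw [e, abs_mul, mul_comm 2]
    gcongr
    exact (abs_add_le _ _).trans (by linarith [abs_sin_le_one θ, abs_sin_le_one η])
  have e : pruferField A W lam x θ - pruferField A W lam x η
      = A x * ((cos θ + W x * sin θ) ^ 2 - (cos η + W x * sin η) ^ 2)
        + lam * (sin θ ^ 2 - sin η ^ 2) := by simp only [pruferField]; ring
  rw [e]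
  calc _ ≤ |A x| * |(cos θ + W x * sin θ) ^ 2 - (cos η + W x * sin η) ^ 2|
        + |lam| * |sin θ ^ 2 - sin η ^ 2| := by
        rw [← abs_mul, ← abs_mul]; exact abs_add_le _ _
    _ ≤ E * (2 * (1 + M) ^ 2 * |θ - η|) + |lam| * (2 * |θ - η|) := by
        rw [abs_of_nonneg hA0]
        gcongr
        exact hA0.trans hE
    _ = _ := by ring

theorem abs_pruferField_le {A W : ℝ → ℝ} {E M x : ℝ} (hA0 : 0 ≤ A x) (hE : A x ≤ E)
    (hM : |W x| ≤ M) (lam θ : ℝ) : |pruferField A W lam x θ| ≤ E * (1 + M) ^ 2 + |lam| := by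
  have hM0 : 0 ≤ M := (abs_nonneg _).trans hM
  have hsum : |cos θ + W x * sin θ| ≤ 1 + M :=
    calc |cos θ + W x * sin θ| ≤ |cos θ| + |W x * sin θ| := abs_add_le _ _
      _ = |cos θ| + |W x| * |sin θ| := by rw [abs_mul]
      _ ≤ 1 + M * 1 := by
        gcongr
        · exact abs_cos_le_one θ
        · exact abs_sin_le_one θ
      _ = 1 + M := by ring
  calc |pruferField A W lam x θ|
      ≤ |A x * (cos θ + W x * sin θ) ^ 2| + |lam * sin θ ^ 2| := abs_add_le _ _
    _ = A x * |cos θ + W x * sin θ| ^ 2 + |lam| * sin θ ^ 2 := by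
        rw [abs_mul, abs_mul, abs_pow, abs_of_nonneg hA0, abs_of_nonneg (sq_nonneg (sin θ))]
    _ ≤ E * (1 + M) ^ 2 + |lam| * 1 := by
        gcongr
        · exact hA0.trans hE
        · exact sin_sq_le_one θ
    _ = _ := by ring

theorem IsPruferAngle.continuousOn {A W : ℝ → ℝ} {lam c d : ℝ} {θ : ℝ → ℝ}
    (h : IsPruferAngle A W lam c d θ) : ContinuousOn θ (Icc c d) :=
  fun x hx => (h x hx).continuousWithinAt

theorem IsPruferAngle.hasDerivWithinAt_Ici {A W : ℝ → ℝ} {lam c d : ℝ} {θ : ℝ → ℝ}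
    (h : IsPruferAngle A W lam c d θ) {x : ℝ} (hx : x ∈ Ico c d) :
    HasDerivWithinAt θ (pruferField A W lam x (θ x)) (Ici x) x :=
  (h x (Ico_subset_Icc_self hx)).mono_of_mem_nhdsWithin (Icc_mem_nhdsGE_of_mem hx)

theorem IsPruferAngle.mono {A W : ℝ → ℝ} {lam c d c' d' : ℝ} {θ : ℝ → ℝ}
    (h : IsPruferAngle A W lam c d θ) (hc : c ≤ c') (hd : d' ≤ d) :
    IsPruferAngle A W lam c' d' θ :=
  fun x hx => (h x (Icc_subset_Icc hc hd hx)).mono (Icc_subset_Icc hc hd)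

/-- The field is a quadratic form in `(cos θ, sin θ)`, hence `π`-periodic. Shifts move a solution to
the branch needed for a comparison. -/
theorem IsPruferAngle.add_pi {A W : ℝ → ℝ} {lam c d : ℝ} {θ : ℝ → ℝ}
    (h : IsPruferAngle A W lam c d θ) (n : ℤ) :
    IsPruferAngle A W lam c d (fun x => θ x + n * π) := by
  intro x hx
  have e : pruferField A W lam x (θ x + n * π) = pruferField A W lam x (θ x) := by
    have h1 : ((-1 : ℝ) ^ n) ^ 2 = 1 := by
      rw [← zpow_natCast, ← zpow_mul, mul_comm, zpow_mul]; simp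
    simp only [pruferField, sin_add_int_mul_pi, cos_add_int_mul_pi]
    linear_combination (A x * (cos (θ x) + W x * sin (θ x)) ^ 2 + lam * sin (θ x) ^ 2) * h1
  simp only [e]
  exact (h x hx).add_const _

/-- The field is bounded by `B` and Lipschitz uniformly in all angles, so a ball of radius `B (d -
c)` makes a single Picard–Lindelöf step cover the whole interval. -/
theorem exists_isPruferAngle {A W : ℝ → ℝ} (hA : Continuous A)
    (hA0 : ∀ x, 0 < A x) (hW : Continuous W) (lam : ℝ) {c d : ℝ} (hcd : c ≤ d) (θ₀ : ℝ) :
    ∃ θ, θ c = θ₀ ∧ IsPruferAngle A W lam c d θ := by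
  obtain ⟨E, ε, M, hε, hM0, hb⟩ := exists_bounds_of_continuous hA hA0 hW c d
  have hE0 : 0 ≤ E := by
    have := hb c ⟨le_rfl, hcd⟩
    linarith
  set K : NNReal := ⟨E * (2 * (1 + M) ^ 2) + 2 * |lam|, by positivity⟩ with hK
  set B : NNReal := ⟨E * (1 + M) ^ 2 + |lam|, by positivity⟩ with hB
  have hPL : IsPicardLindelof (pruferField A W lam) (tmin := c) (tmax := d) ⟨c, le_rfl, hcd⟩ θ₀
      (B * ⟨d - c, sub_nonneg.2 hcd⟩) 0 B K := by
    refine ⟨fun x hx => ?_, fun θ _ => ?_, fun x hx θ _ => ?_, ?_⟩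
    · refine LipschitzOnWith.of_dist_le_mul fun θ _ η _ => ?_
      exact abs_pruferField_sub_le (hA0 x).le (hb x hx).2.1 (hb x hx).2.2 lam θ η
    · unfold pruferField
      fun_prop
    · exact abs_pruferField_le (hA0 x).le (hb x hx).2.1 (hb x hx).2.2 lam θ
    · have : ((B * ⟨d - c, sub_nonneg.2 hcd⟩ : NNReal) : ℝ) = B * (d - c) := NNReal.coe_mul _ _
      simp [hcd, this]
  exact hPL.exists_eq_forall_mem_Icc_hasDerivWithinAt₀

/-- Comparison of a subsolution and a supersolution of the Prüfer equation. -/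
theorem exists_pos_mul_sub_le_of_sub_super {A W : ℝ → ℝ} (hA : Continuous A)
    (hA0 : ∀ x, 0 < A x) (hW : Continuous W) (lam c d : ℝ) :
    ∃ K : ℝ, 0 ≤ K ∧ ∀ (y y' z z' : ℝ → ℝ), ContinuousOn y (Icc c d) → ContinuousOn z (Icc c d) →
      (∀ x ∈ Ico c d, HasDerivWithinAt y (y' x) (Ici x) x) →
      (∀ x ∈ Ico c d, HasDerivWithinAt z (z' x) (Ici x) x) →
      (∀ x ∈ Ico c d, y' x ≤ pruferField A W lam x (y x)) →
      (∀ x ∈ Ico c d, pruferField A W lam x (z x) ≤ z' x) → y c ≤ z c →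
      ∀ x ∈ Icc c d, (z c - y c) * exp (-(K * (x - c))) ≤ z x - y x := by
  obtain ⟨E, ε, M, hε, hM0, hb⟩ := exists_bounds_of_continuous hA hA0 hW c d
  refine ⟨max (E * (2 * (1 + M) ^ 2) + 2 * |lam|) 0, le_max_right _ _, ?_⟩
  intro y y' z z' hy hz hy' hz' hsub hsup h0
  refine mul_exp_le_of_neg_mul_abs_le_deriv (w := fun x => z x - y x)
    (w' := fun x => z' x - y' x) (le_max_right _ _) (hz.sub hy)
    (fun x hx => (hz' x hx).sub (hy' x hx)) (sub_nonneg.2 h0) fun x hx => ?_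
  have hx' := Ico_subset_Icc_self hx
  have h1 := (abs_le.1 (abs_pruferField_sub_le (hA0 x).le (hb x hx').2.1 (hb x hx').2.2 lam (z x)
    (y x))).1
  have h2 := hsub x hx
  have h3 := hsup x hx
  have h4 : (E * (2 * (1 + M) ^ 2) + 2 * |lam|) * |z x - y x|
    ≤ max (E * (2 * (1 + M) ^ 2) + 2 * |lam|) 0 * |z x - y x| := by
    gcongr
    exact le_max_left _ _
  linarith

/-- Raising the parameter adds a nonnegative multiple of `sin²` to the field, so `η` is a
supersolution for `lam`; the exponential lower bound on the gap keeps a strict inequality strict.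
With `lam = lam'` this contains uniqueness and non-crossing. -/
theorem IsPruferAngle.le_of_le {A W : ℝ → ℝ} (hA : Continuous A)
    (hA0 : ∀ x, 0 < A x) (hW : Continuous W) {lam lam' c d : ℝ} {θ η : ℝ → ℝ} (hlam : lam ≤ lam')
    (hθ : IsPruferAngle A W lam c d θ) (hη : IsPruferAngle A W lam' c d η) (h0 : θ c ≤ η c) :
    ∀ x ∈ Icc c d, θ x ≤ η x ∧ (θ c < η c → θ x < η x) := by
  obtain ⟨K, hK, H⟩ := exists_pos_mul_sub_le_of_sub_super hA hA0 hW lam c d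
  intro x hx
  have h1 := H θ _ η _ hθ.continuousOn hη.continuousOn (fun x hx => hθ.hasDerivWithinAt_Ici hx)
    (fun x hx => hη.hasDerivWithinAt_Ici hx) (fun x _ => le_rfl) (fun x hx => by
      simp only [pruferField]; nlinarith [sq_nonneg (sin (η x))]) h0 x hx
  have hE := exp_pos (-(K * (x - c)))
  refine ⟨by nlinarith, fun h => by nlinarith⟩

/-- At angle `0` the field is `A > 0` whatever the parameter, so the constant `0` is a subsolution.
This is why branches are numbered from `0`. -/
theorem IsPruferAngle.pos {A W : ℝ → ℝ} (hA : Continuous A)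
    (hA0 : ∀ x, 0 < A x) (hW : Continuous W) {lam c d : ℝ} {θ : ℝ → ℝ} (hθ : IsPruferAngle A W lam c d θ)
    (h0 : 0 < θ c) : ∀ x ∈ Icc c d, 0 < θ x := by
  obtain ⟨K, hK, H⟩ := exists_pos_mul_sub_le_of_sub_super hA hA0 hW lam c d
  intro x hx
  have h1 := H (fun _ => 0) (fun _ => 0) θ _ continuousOn_const hθ.continuousOn
    (fun x hx => hasDerivWithinAt_const _ _ _) (fun x hx => hθ.hasDerivWithinAt_Ici hx)
    (fun x _ => by simp [pruferField, (hA0 x).le]) (fun x _ => le_rfl) h0.le x hx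
  have hE := exp_pos (-(K * (x - c)))
  simp only [sub_zero] at h1
  nlinarith

/-- The Prüfer angle is strictly increasing in the spectral parameter. -/
theorem IsPruferAngle.lt_of_lt {A W : ℝ → ℝ} (hA : Continuous A)
    (hA0 : ∀ x, 0 < A x) (hW : Continuous W) {lam lam' c d : ℝ} (hcd : c < d) {θ η : ℝ → ℝ} (hlam : lam < lam')
    (hθ : IsPruferAngle A W lam c d θ) (hη : IsPruferAngle A W lam' c d η) (h0 : θ c = η c)
    (hs : sin (θ c) ≠ 0) : θ d < η d := by
  have hle := fun x hx => (hθ.le_of_le hA hA0 hW hlam.le hη h0.le x hx).1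
  refine lt_of_le_of_ne (hle d ⟨hcd.le, le_rfl⟩) fun hd => ?_
  -- A strict gap at any point would persist up to `d`. So equality at `d` forces equality
  -- everywhere, and comparing derivatives at `c` gives `(lam' - lam) sin² = 0`.
  have heq : EqOn θ η (Icc c d) := by
    intro x hx
    refine le_antisymm (hle x hx) (not_lt.1 fun hlt => ?_)
    have := ((hθ.mono hx.1 le_rfl).le_of_le hA hA0 hW hlam.le (hη.mono hx.1 le_rfl) (hle x hx)
      d ⟨hx.2, le_rfl⟩).2 hlt
    exact this.ne hd
  have hcm : c ∈ Icc c d := ⟨le_rfl, hcd.le⟩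
  have h1 := hθ c hcm
  have h2 := (hη c hcm).congr heq h0
  have h3 := (uniqueDiffOn_Icc hcd c hcm).eq_deriv _ h1 h2
  rw [h0] at hs h3
  simp only [pruferField] at h3
  have : (lam' - lam) * sin (η c) ^ 2 = 0 := by linarith
  rcases mul_eq_zero.1 this with h | h
  · linarith
  · exact hs (pow_eq_zero_iff (two_ne_zero) |>.1 h)

/-! ### Dependence of the final angle on the spectral parameter -/

/-- `l j` is the unique spectral parameter for which the solution of the Prüfer equation with
initial angle `θ₀` at `c` reaches the angle `κ + j π` at `d`. -/
def IsSpectralSequence (A W : ℝ → ℝ) (c d θ₀ κ : ℝ) (l : ℕ → ℝ) : Prop :=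
  StrictMono l ∧ ∀ lam θ, θ c = θ₀ → IsPruferAngle A W lam c d θ → ∀ j : ℕ,
    (θ d < κ + j * π ↔ lam < l j) ∧ (θ d = κ + j * π ↔ lam = l j)

/-- The Prüfer angle depends continuously on the spectral parameter. -/
theorem continuous_pruferAngle_right {A W : ℝ → ℝ} (hA : Continuous A)
    (hA0 : ∀ x, 0 < A x) (hW : Continuous W) {c d : ℝ} (hcd : c ≤ d) {Θ : ℝ → ℝ → ℝ} {θ₀ : ℝ}
    (h0 : ∀ lam, Θ lam c = θ₀) (hΘ : ∀ lam, IsPruferAngle A W lam c d (Θ lam)) :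
    Continuous fun lam => Θ lam d := by
  obtain ⟨E, ε, M, hε, hM0, hb⟩ := exists_bounds_of_continuous hA hA0 hW c d
  have hE0 : 0 ≤ E := by
    have := hb c ⟨le_rfl, hcd⟩
    linarith
  rw [continuous_iff_continuousAt]
  intro lam
  set K : ℝ := E * (2 * (1 + M) ^ 2) + 2 * |lam| with hK
  -- Grönwall with zero initial error: changing the parameter perturbs the field by `(mu - lam)
  -- sin²`, of size at most `|mu - lam|`.
  have key : ∀ mu, ‖Θ mu d - Θ lam d‖ ≤ gronwallBound 0 K |mu - lam| (d - c) := by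
    intro mu
    refine norm_le_gronwallBound_of_norm_deriv_right_le (f := fun x => Θ mu x - Θ lam x)
      ((hΘ mu).continuousOn.sub (hΘ lam).continuousOn)
      (fun x hx => ((hΘ mu).hasDerivWithinAt_Ici hx).sub ((hΘ lam).hasDerivWithinAt_Ici hx))
      (by simp [h0]) (fun x hx => ?_) d ⟨hcd, le_rfl⟩
    have hx' := Ico_subset_Icc_self hx
    have h1 := abs_pruferField_sub_le (hA0 x).le (hb x hx').2.1 (hb x hx').2.2 lam (Θ mu x)
      (Θ lam x)
    have e : pruferField A W mu x (Θ mu x) - pruferField A W lam x (Θ lam x)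
      = (pruferField A W lam x (Θ mu x) - pruferField A W lam x (Θ lam x))
        + (mu - lam) * sin (Θ mu x) ^ 2 := by simp only [pruferField]; ring
    rw [e, norm_eq_abs, norm_eq_abs]
    refine (abs_add_le _ _).trans (add_le_add h1 ?_)
    rw [abs_mul, abs_of_nonneg (sq_nonneg (sin _))]
    exact mul_le_of_le_one_right (abs_nonneg _) (sin_sq_le_one _)
  have hlim : Tendsto (fun mu => gronwallBound 0 K |mu - lam| (d - c)) (𝓝 lam) (𝓝 0) := by
    have h1 := ((gronwallBound_continuous_ε 0 K (d - c)).comp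
      ((continuous_id.sub (continuous_const (y := lam))).abs)).tendsto lam
    simpa [gronwallBound_ε0_δ0, Function.comp_def] using h1
  have := squeeze_zero_norm key hlim
  exact tendsto_sub_nhds_zero_iff.1 this

/-- For very negative spectral parameter the Prüfer angle ends near zero. -/
theorem exists_pruferAngle_lt {A W : ℝ → ℝ} (hA : Continuous A)
    (hA0 : ∀ x, 0 < A x) (hW : Continuous W) {c d : ℝ} (hcd : c < d) {θ₀ κ : ℝ} (h0 : θ₀ < π) (hκ : 0 < κ) :
    ∃ lam : ℝ, ∀ θ, θ c = θ₀ → IsPruferAngle A W lam c d θ → θ d < κ := by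
  obtain ⟨E, ε, M, hε, hM0, hb⟩ := exists_bounds_of_continuous hA hA0 hW c d
  have hE0 : 0 ≤ E := by
    have := hb c ⟨le_rfl, hcd.le⟩
    linarith
  obtain ⟨δ, hδ0, hδ⟩ : ∃ δ : ℝ, 0 < δ ∧ δ < κ ∧ δ < π - θ₀ ∧ δ < π / 2 := by
    obtain ⟨δ, h1, h2⟩ := exists_between (show 0 < min κ (min (π - θ₀) (π / 2)) by
      simp only [lt_min_iff]; exact ⟨hκ, by linarith, by positivity⟩)
    simp only [lt_min_iff] at h2
    exact ⟨δ, h1, h2.1, h2.2.1, h2.2.2⟩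
  obtain ⟨hδκ, hδθ, hδπ⟩ := hδ
  have hsδ : 0 < sin δ := sin_pos_of_pos_of_lt_pi hδ0 (by linarith [pi_pos])
  -- Slope of the line from `π - δ` at `c` down to `δ` at `d`. On that line `sin² ≥ sin² δ`, and
  -- `lam` solves `C + lam sin² δ = s`, which makes the line a supersolution lying above `θ`.
  set s : ℝ := (δ - (π - δ)) / (d - c) with hs
  have hdc : 0 < d - c := by linarith
  have hs0 : s ≤ 0 := div_nonpos_of_nonpos_of_nonneg (by linarith) hdc.le
  set C : ℝ := E * (1 + M) ^ 2 with hC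
  set lam : ℝ := (s - C) / sin δ ^ 2 with hlam
  have hC0 : 0 ≤ C := by positivity
  have hlam0 : lam ≤ 0 := div_nonpos_of_nonpos_of_nonneg (by linarith) (by positivity)
  refine ⟨lam, fun θ hθc hθ => ?_⟩
  obtain ⟨K, hK, H⟩ := exists_pos_mul_sub_le_of_sub_super hA hA0 hW lam c d
  set b : ℝ → ℝ := fun x => (π - δ) + s * (x - c) with hbdef
  have hbd : b d = δ := by
    simp only [hbdef, hs]
    field_simp
    ring
  have hbc : b c = π - δ := by simp [hbdef]
  have hb' : ∀ x, HasDerivAt b s x := fun x => by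
    exact ((((hasDerivAt_id x).sub_const c).const_mul s).const_add (π - δ)).congr_deriv
      (mul_one s)
  have h1 := H θ _ b (fun _ => s) hθ.continuousOn (by simp only [hbdef]; fun_prop)
    (fun x hx => hθ.hasDerivWithinAt_Ici hx) (fun x _ => (hb' x).hasDerivWithinAt)
    (fun x _ => le_rfl) (fun x hx => ?_) (by rw [hθc, hbc]; linarith) d ⟨hcd.le, le_rfl⟩
  · rw [hbd, hbc, hθc] at h1
    have := mul_nonneg (show 0 ≤ π - δ - θ₀ by linarith) (exp_pos (-(K * (d - c)))).le
    linarith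
  · have hx' := Ico_subset_Icc_self hx
    have hbx1 : b x ≤ π - δ := by
      have := mul_nonpos_of_nonpos_of_nonneg hs0 (sub_nonneg.2 hx.1)
      simp only [hbdef]; linarith
    have hbx2 : δ ≤ b x := by
      rw [← hbd]
      have : s * (d - x) ≤ 0 := mul_nonpos_of_nonpos_of_nonneg hs0 (sub_nonneg.2 hx.2.le)
      simp only [hbdef]; linarith
    have hsin : sin δ ≤ sin (b x) := by
      rcases le_total (b x) (π / 2) with h | h
      · exact sin_le_sin_of_le_of_le_pi_div_two (by linarith) h hbx2
      · rw [← sin_pi_sub (b x)]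
        exact sin_le_sin_of_le_of_le_pi_div_two (by linarith) (by linarith) (by linarith)
    have hsq : sin δ ^ 2 ≤ sin (b x) ^ 2 := by gcongr
    have hF0 : pruferField A W 0 x (b x) ≤ C := by
      have := (le_abs_self _).trans
        (abs_pruferField_le (hA0 x).le (hb x hx').2.1 (hb x hx').2.2 0 (b x))
      simpa using this
    have e : pruferField A W lam x (b x) = pruferField A W 0 x (b x) + lam * sin (b x) ^ 2 := by
      simp [pruferField]
    have h2 : lam * sin (b x) ^ 2 ≤ lam * sin δ ^ 2 := mul_le_mul_of_nonpos_left hsq hlam0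
    have h3 : lam * sin δ ^ 2 = s - C := by
      rw [hlam]; field_simp
    rw [e]; linarith

/-- The function is a global smooth branch of the angle `φ` with `tan φ = k tan t`, because `tan (φ
- t) = (k - 1) tan t / (1 + k tan² t)`. It differs from `t` by less than `π / 2`. -/
theorem hasDerivAt_scaledAngle {k : ℝ} (hk : 0 < k) (t : ℝ) :
    HasDerivAt (fun t => t + arctan ((k - 1) * (sin t * cos t) / (cos t ^ 2 + k * sin t ^ 2)))
      (k / (cos t ^ 2 + k ^ 2 * sin t ^ 2)) t := by
  have hsc := sin_sq_add_cos_sq t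
  have hD : 0 < cos t ^ 2 + k * sin t ^ 2 := by
    rcases eq_or_ne (sin t) 0 with h | h
    · rw [h] at hsc ⊢; nlinarith
    · have : 0 < sin t ^ 2 := by positivity
      nlinarith [sq_nonneg (cos t), mul_pos hk this]
  have hD2 : 0 < cos t ^ 2 + k ^ 2 * sin t ^ 2 := by
    rcases eq_or_ne (sin t) 0 with h | h
    · rw [h] at hsc ⊢; nlinarith
    · have : 0 < sin t ^ 2 := by positivity
      nlinarith [sq_nonneg (cos t), mul_pos (pow_pos hk 2) this]
  have h1 : HasDerivAt (fun t => (k - 1) * (sin t * cos t))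
      ((k - 1) * (cos t * cos t + sin t * (-sin t))) t :=
    ((hasDerivAt_sin t).mul (hasDerivAt_cos t)).const_mul _
  have h2 : HasDerivAt (fun t => cos t ^ 2 + k * sin t ^ 2)
      (2 * cos t * (-sin t) + k * (2 * sin t * cos t)) t := by
    exact (((hasDerivAt_cos t).pow 2).add (((hasDerivAt_sin t).pow 2).const_mul k)).congr_deriv
      (by simp)
  refine ((hasDerivAt_id t).add (h1.div h2 hD.ne').arctan).congr_deriv ?_
  set S := sin t
  set C := cos t
  have hN : 1 + ((k - 1) * (S * C) / (C ^ 2 + k * S ^ 2)) ^ 2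
      = (C ^ 2 + k ^ 2 * S ^ 2) / (C ^ 2 + k * S ^ 2) ^ 2 := by
    rw [div_pow, eq_div_iff (by positivity)]
    rw [add_mul, div_mul_cancel₀ _ (by positivity)]
    have : (C ^ 2 + k ^ 2 * S ^ 2) = (C ^ 2 + k ^ 2 * S ^ 2) * (S ^ 2 + C ^ 2) := by
      rw [hsc, mul_one]
    rw [this]; ring
  change 1 + 1 / (1 + ((k - 1) * (S * C) / (C ^ 2 + k * S ^ 2)) ^ 2) * _ = _
  rw [hN]
  have : (1 : ℝ) / ((C ^ 2 + k ^ 2 * S ^ 2) / (C ^ 2 + k * S ^ 2) ^ 2)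
      * (((k - 1) * (C * C + S * -S) * (C ^ 2 + k * S ^ 2)
        - (k - 1) * (S * C) * (2 * C * -S + k * (2 * S * C))) / (C ^ 2 + k * S ^ 2) ^ 2)
      = ((k - 1) * (C * C + S * -S) * (C ^ 2 + k * S ^ 2)
        - (k - 1) * (S * C) * (2 * C * -S + k * (2 * S * C))) / (C ^ 2 + k ^ 2 * S ^ 2) := by
    field_simp
  rw [this, eq_div_iff hD2.ne', add_mul, div_mul_cancel₀ _ hD2.ne']
  have e : (k - 1) * (C * C + S * -S) * (C ^ 2 + k * S ^ 2)
        - (k - 1) * (S * C) * (2 * C * -S + k * (2 * S * C))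
      = (k - 1) * (C ^ 2 - k * S ^ 2) * (S ^ 2 + C ^ 2) := by ring
  rw [e, hsc]
  have hC : C ^ 2 = 1 - S ^ 2 := by linarith
  rw [hC]; ring

/-- For large spectral parameter the Prüfer angle becomes arbitrarily large. -/
theorem exists_lt_pruferAngle {A W : ℝ → ℝ} (hA : Continuous A)
    (hA0 : ∀ x, 0 < A x) (hW : Continuous W) {c d : ℝ} (hcd : c < d) (θ₀ N : ℝ) :
    ∃ lam : ℝ, ∀ θ, θ c = θ₀ → IsPruferAngle A W lam c d θ → N < θ d := by
  obtain ⟨E, ε, M, hε, hM0, hb⟩ := exists_bounds_of_continuous hA hA0 hW c d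
  have hE0 : 0 ≤ E := by
    have := hb c ⟨le_rfl, hcd.le⟩
    linarith
  have hdc : 0 < d - c := by linarith
  -- The rescaled angle will grow at rate at least `k ε / 2`; this `k` covers `N - θ₀` plus the
  -- total loss `π` from the two arctangents at the end points.
  set k : ℝ := max 1 ((N - θ₀ + π + 1) / (ε / 2 * (d - c))) with hk
  have hk0 : 0 < k := lt_max_of_lt_left one_pos
  have hkN : N - θ₀ + π + 1 ≤ k * (ε / 2) * (d - c) := by
    have := le_max_right 1 ((N - θ₀ + π + 1) / (ε / 2 * (d - c)))
    rw [div_le_iff₀ (by positivity)] at this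
    linarith
  -- `E M²` absorbs the contribution of `W`; `ε / 2 * k²` leaves the field at least `ε / 2 (cos² +
  -- k² sin²)`, which cancels the denominator in the derivative of the rescaled angle.
  refine ⟨E * M ^ 2 + ε / 2 * k ^ 2, fun θ hθc hθ => ?_⟩
  set lam := E * M ^ 2 + ε / 2 * k ^ 2 with hlam
  set G : ℝ → ℝ := fun t =>
    t + arctan ((k - 1) * (sin t * cos t) / (cos t ^ 2 + k * sin t ^ 2)) with hG
  have hGd := fun t => hasDerivAt_scaledAngle hk0 t
  have hcomp : ∀ x ∈ Icc c d, HasDerivWithinAt (fun x => G (θ x) - k * (ε / 2) * x)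
      (k / (cos (θ x) ^ 2 + k ^ 2 * sin (θ x) ^ 2) * pruferField A W lam x (θ x)
        - k * (ε / 2)) (Icc c d) x := by
    intro x hx
    have h1 := (hGd (θ x)).comp_hasDerivWithinAt x (hθ x hx)
    have h2 := ((hasDerivAt_id x).const_mul (k * (ε / 2))).hasDerivWithinAt (s := Icc c d)
    refine (h1.sub h2).congr_deriv (by ring)
  have hmono : MonotoneOn (fun x => G (θ x) - k * (ε / 2) * x) (Icc c d) := by
    refine monotoneOn_of_hasDerivWithinAt_nonneg (convex_Icc c d)
      (fun x hx => (hcomp x hx).continuousWithinAt)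
      (fun x hx => (hcomp x (interior_subset hx)).mono interior_subset) fun x hx => ?_
    have hx' := interior_subset hx
    obtain ⟨b1, b2, b3⟩ := hb x hx'
    set S := sin (θ x)
    set C := cos (θ x)
    have hsc : S ^ 2 + C ^ 2 = 1 := sin_sq_add_cos_sq _
    have hD2 : 0 < C ^ 2 + k ^ 2 * S ^ 2 := by
      rcases eq_or_ne S 0 with h | h
      · rw [h] at hsc ⊢; nlinarith
      · have : 0 < S ^ 2 := by positivity
        nlinarith [sq_nonneg C, mul_pos (pow_pos hk0 2) this]
    have hq : C ^ 2 / 2 - M ^ 2 * S ^ 2 ≤ (C + W x * S) ^ 2 := by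
      have : W x ^ 2 ≤ M ^ 2 := by rw [← sq_abs]; gcongr
      nlinarith [sq_nonneg (C + 2 * (W x * S)), mul_le_mul_of_nonneg_right this (sq_nonneg S)]
    have hF : ε / 2 * (C ^ 2 + k ^ 2 * S ^ 2) ≤ pruferField A W lam x (θ x) := by
      have h1 : A x * (C ^ 2 / 2 - M ^ 2 * S ^ 2) ≤ A x * (C + W x * S) ^ 2 :=
        mul_le_mul_of_nonneg_left hq (hA0 x).le
      have h2 : A x * (M ^ 2 * S ^ 2) ≤ E * (M ^ 2 * S ^ 2) := by gcongr
      have h3 : ε * (C ^ 2 / 2) ≤ A x * (C ^ 2 / 2) := by gcongr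
      have e : pruferField A W lam x (θ x)
        = A x * (C + W x * S) ^ 2 + (E * M ^ 2 + ε / 2 * k ^ 2) * S ^ 2 := rfl
      rw [e]; linarith
    have : k * (ε / 2) ≤ k / (C ^ 2 + k ^ 2 * S ^ 2) * pruferField A W lam x (θ x) :=
      calc k * (ε / 2) = k / (C ^ 2 + k ^ 2 * S ^ 2) * (ε / 2 * (C ^ 2 + k ^ 2 * S ^ 2)) := by
            field_simp
        _ ≤ _ := by gcongr
    linarith
  have h1 := hmono ⟨le_rfl, hcd.le⟩ ⟨hcd.le, le_rfl⟩ hcd.le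
  have h2 := arctan_lt_pi_div_two
    ((k - 1) * (sin (θ d) * cos (θ d)) / (cos (θ d) ^ 2 + k * sin (θ d) ^ 2))
  have h3 := neg_pi_div_two_lt_arctan
    ((k - 1) * (sin (θ c) * cos (θ c)) / (cos (θ c) ^ 2 + k * sin (θ c) ^ 2))
  simp only [hG] at h1
  rw [← hθc] at hkN
  linarith

/-- The values of the spectral parameter for which the Prüfer angle ends in `κ + π ℤ`. -/
theorem exists_spectral_sequence {A W : ℝ → ℝ} (hA : Continuous A)
    (hA0 : ∀ x, 0 < A x) (hW : Continuous W) {c d : ℝ} (hcd : c < d) {θ₀ κ : ℝ} (h0 : θ₀ ∈ Ioo 0 π)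
    (hκ : κ ∈ Ioo 0 π) :
    ∃ l, IsSpectralSequence A W c d θ₀ κ l := by
  choose Θ hΘ0 hΘ using fun lam => exists_isPruferAngle hA hA0 hW lam hcd.le θ₀
  have hcont := continuous_pruferAngle_right hA hA0 hW hcd.le hΘ0 hΘ
  have hsin : sin θ₀ ≠ 0 := (sin_pos_of_mem_Ioo h0).ne'
  have hmono : StrictMono fun lam => Θ lam d := fun lam mu h =>
    (hΘ lam).lt_of_lt hA hA0 hW hcd h (hΘ mu) (by rw [hΘ0, hΘ0]) (by rwa [hΘ0])
  have hex : ∀ j : ℕ, ∃ lam, Θ lam d = κ + j * π := by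
    intro j
    obtain ⟨l1, h1⟩ := exists_pruferAngle_lt hA hA0 hW hcd h0.2 hκ.1
    obtain ⟨l2, h2⟩ := exists_lt_pruferAngle hA hA0 hW hcd θ₀ (κ + j * π)
    have h1' := h1 _ (hΘ0 l1) (hΘ l1)
    have h2' := h2 _ (hΘ0 l2) (hΘ l2)
    have hj : 0 ≤ (j : ℝ) * π := by positivity
    exact mem_range_of_exists_le_of_exists_ge hcont ⟨l1, by linarith⟩ ⟨l2, h2'.le⟩
  choose l hl using hex
  refine ⟨l, fun i j hij => ?_, fun lam θ hθ0 hθ j => ?_⟩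
  · rw [← hmono.lt_iff_lt]
    simp only [hl]
    have : (i : ℝ) < j := by exact_mod_cast hij
    gcongr
  · have e : θ d = Θ lam d := le_antisymm
      (hθ.le_of_le hA hA0 hW le_rfl (hΘ lam) (by rw [hθ0, hΘ0]) d ⟨hcd.le, le_rfl⟩).1
      ((hΘ lam).le_of_le hA hA0 hW le_rfl hθ (by rw [hθ0, hΘ0]) d ⟨hcd.le, le_rfl⟩).1
    rw [e, ← hl]
    exact ⟨hmono.lt_iff_lt, hmono.injective.eq_iff⟩

/-! ### Interlacing of spectral sequences by counting branches -/

open NeumannDecoupling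

/-- The final angle for parameter `x` lies below `κ + N π` for some `N`, which means `x < l N`. -/
theorem IsSpectralSequence.finite_setOf_le {A W : ℝ → ℝ} (hA : Continuous A)
    (hA0 : ∀ x, 0 < A x) (hW : Continuous W) {c d θ₀ κ : ℝ} (hcd : c < d) {l : ℕ → ℝ}
    (hl : IsSpectralSequence A W c d θ₀ κ l) (x : ℝ) : {j | l j ≤ x}.Finite := by
  obtain ⟨θ, hθ0, hθ⟩ := exists_isPruferAngle hA hA0 hW x hcd.le θ₀
  obtain ⟨N, hN⟩ := exists_nat_gt ((θ d - κ) / π)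
  have hx : x < l N := by
    rw [← (hl.2 x θ hθ0 hθ N).1]
    rw [div_lt_iff₀ pi_pos] at hN
    linarith
  refine (finite_Iio N).subset fun j (hj : l j ≤ x) => ?_
  exact hl.1.lt_iff_lt.1 (hj.trans_lt hx)

/-- Interlacing, in terms of counting: among the members of `l` and `m`, at least `i + 1` are
at most `n i`. -/
theorem IsSpectralSequence.exists_add_eq_forall_le {A W : ℝ → ℝ} (hA : Continuous A)
    (hA0 : ∀ x, 0 < A x) (hW : Continuous W) {α γ β κα κγ κβ : ℝ} (hαγ : α < γ)
    (hγβ : γ < β) {l m n : ℕ → ℝ}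
    (hl : IsSpectralSequence A W α γ κα κγ l) (hm : IsSpectralSequence A W γ β κγ κβ m)
    (hn : IsSpectralSequence A W α β κα κβ n) (i : ℕ) :
    ∃ k k', k + k' = i + 1 ∧ (∀ j < k, l j ≤ n i) ∧ ∀ j < k', m j ≤ n i := by
  obtain ⟨θ, hθ0, hθ⟩ := exists_isPruferAngle hA hA0 hW (n i) (hαγ.trans hγβ).le κα
  obtain ⟨η, hη0, hη⟩ := exists_isPruferAngle hA hA0 hW (n i) hγβ.le κγ
  have hend := (hn.2 _ _ hθ0 hθ i).2.2 rfl
  have hex : ∃ k, n i < l k := by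
    by_contra! h
    exact infinite_univ ((hl.finite_setOf_le hA hA0 hW hαγ (n i)).subset fun j _ => h j)
  classical
  set k := Nat.find hex with hk
  have hk1 : n i < l k := Nat.find_spec hex
  have hk2 : ∀ j < k, l j ≤ n i := fun j hj => not_lt.1 (Nat.find_min hex hj)
  rcases le_or_gt (i + 1) k with h | h
  · exact ⟨i + 1, 0, by simp, fun j hj => hk2 j (hj.trans_le h), by simp⟩
  refine ⟨k, i + 1 - k, by omega, hk2, fun j hj => ?_⟩
  have h1 : θ γ < κγ + k * π := (hl.2 _ _ hθ0 (hθ.mono le_rfl hγβ.le) k).1.2 hk1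
  -- `θ` enters `[γ, β]` strictly below `η + k π`, so `κβ + i π < η β + k π`. Hence `η` has passed
  -- the levels `0, …, i - k`, which gives `i + 1 - k` members of `m`.
  have h2 := ((hθ.mono hαγ.le le_rfl).le_of_le hA hA0 hW le_rfl (hη.add_pi k)
    (by simp [hη0, h1.le]) β ⟨hγβ.le, le_rfl⟩).2 (by simpa [hη0] using h1)
  have h3 : m j < n i ∨ m j = n i ∨ n i < m j := lt_trichotomy _ _
  rcases h3 with h3 | h3 | h3
  · exact h3.le
  · exact h3.le
  · exfalso
    rw [← (hm.2 _ _ hη0 hη j).1] at h3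
    have h4 : (j : ℝ) ≤ i - k := by
      have : j + k ≤ i := by omega
      have : (j : ℝ) + k ≤ i := by exact_mod_cast this
      linarith
    have h5 := mul_le_mul_of_nonneg_right h4 pi_pos.le
    rw [hend] at h2
    push_cast at h2
    linarith

/-- Interlacing, in terms of counting: among the members of `l` and `m`, at most `i + 1` are
less than `n i`. -/
theorem IsSpectralSequence.exists_add_eq_forall_ge {A W : ℝ → ℝ} (hA : Continuous A)
    (hA0 : ∀ x, 0 < A x) (hW : Continuous W) {α γ β κα κγ κβ : ℝ} (hαγ : α < γ)
    (hγβ : γ < β) (hα : κα ∈ Ioo 0 π) (hγ : κγ ∈ Ioo 0 π) (hβ : κβ ∈ Ioo 0 π) {l m n : ℕ → ℝ}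
    (hl : IsSpectralSequence A W α γ κα κγ l) (hm : IsSpectralSequence A W γ β κγ κβ m)
    (hn : IsSpectralSequence A W α β κα κβ n) (i : ℕ) :
    ∃ k k', k + k' = i + 1 ∧ (∀ j, k ≤ j → n i ≤ l j) ∧ ∀ j, k' ≤ j → n i ≤ m j := by
  obtain ⟨θ, hθ0, hθ⟩ := exists_isPruferAngle hA hA0 hW (n i) (hαγ.trans hγβ).le κα
  obtain ⟨η, hη0, hη⟩ := exists_isPruferAngle hA hA0 hW (n i) hγβ.le κγ
  have hend := (hn.2 _ _ hθ0 hθ i).2.2 rfl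
  have hex : ∃ k, n i ≤ l k := by
    by_contra! h
    exact infinite_univ ((hl.finite_setOf_le hA hA0 hW hαγ (n i)).subset fun j _ => (h j).le)
  classical
  set k := Nat.find hex with hk
  have hk1 : n i ≤ l k := Nat.find_spec hex
  -- For `k = 0` the level is `κγ - π < 0`, and positivity of the angle replaces the missing
  -- predecessor of `k`.
  have h1 : κγ + ((k - 1 : ℤ) : ℝ) * π < θ γ := by
    rcases Nat.eq_zero_or_pos k with h | h
    · have := hθ.pos hA hA0 hW (by rw [hθ0]; exact hα.1) γ ⟨hαγ.le, hγβ.le⟩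
      rw [h]; push_cast; linarith [hγ.2]
    · have h2 : ¬ n i ≤ l (k - 1) := Nat.find_min hex (by omega)
      have h3 := hl.2 _ _ hθ0 (hθ.mono le_rfl hγβ.le) (k - 1)
      rw [le_iff_lt_or_eq, ← h3.1, ← h3.2, ← le_iff_lt_or_eq, not_le] at h2
      rw [Nat.cast_sub h] at h2
      push_cast at h2 ⊢
      exact h2
  have h2 := ((hη.add_pi (k - 1)).le_of_le hA hA0 hW le_rfl (hθ.mono hαγ.le le_rfl)
    (by simpa [hη0] using h1.le) β ⟨hγβ.le, le_rfl⟩).2 (by simpa [hη0] using h1)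
  have h3 := hη.pos hA hA0 hW (by rw [hη0]; exact hγ.1) β ⟨hγβ.le, le_rfl⟩
  rw [hend] at h2
  push_cast at h2
  -- From `η β > 0` and `κβ < π`; it makes the natural subtraction `i + 1 - k` genuine.
  have hki : k ≤ i + 1 := by
    by_contra! h
    have h4 : (i : ℝ) + 2 ≤ k := by exact_mod_cast h
    have h5 := mul_le_mul_of_nonneg_right h4 pi_pos.le
    linarith [hβ.2]
  refine ⟨k, i + 1 - k, by omega, fun j hj => hk1.trans (hl.1.monotone hj), fun j hj => ?_⟩
  refine le_trans ?_ (hm.1.monotone hj)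
  rw [le_iff_lt_or_eq, ← (hm.2 _ _ hη0 hη _).1]
  left
  rw [Nat.cast_sub hki]
  push_cast
  linarith

/-- A common member of `n` and one of `l`, `m` forces a Neumann condition at `γ`. -/
theorem IsSpectralSequence.ne_of_sin_ne_zero {A W : ℝ → ℝ} (hA : Continuous A)
    (hA0 : ∀ x, 0 < A x) (hW : Continuous W) {α γ β κα κγ κβ : ℝ} (hαγ : α < γ)
    (hγβ : γ < β) {l m n : ℕ → ℝ}
    (hl : IsSpectralSequence A W α γ κα κγ l) (hm : IsSpectralSequence A W γ β κγ κβ m)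
    (hn : IsSpectralSequence A W α β κα κβ n) (i : ℕ) {θ : ℝ → ℝ} (hθ0 : θ α = κα)
    (hθ : IsPruferAngle A W (n i) α β θ) (hsin : sin (θ γ - κγ) ≠ 0) (j : ℕ) :
    n i ≠ l j ∧ n i ≠ m j := by
  refine ⟨fun h => hsin ?_, fun h => hsin ?_⟩
  · have h1 := (hl.2 _ _ hθ0 (hθ.mono le_rfl hγβ.le) j).2.2 h
    rw [h1, add_sub_cancel_left, sin_nat_mul_pi]
  · obtain ⟨η, hη0, hη⟩ := exists_isPruferAngle hA hA0 hW (n i) hγβ.le κγ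
    have hend := (hn.2 _ _ hθ0 hθ i).2.2 rfl
    have hend' := (hm.2 _ _ hη0 hη j).2.2 h
    have hη' := hη.add_pi (i - j)
    have hθ' := hθ.mono hαγ.le le_rfl
    have hβ : η β + ((i - j : ℤ) : ℝ) * π = θ β := by
      rw [hend, hend']; push_cast; ring
    have hmem : β ∈ Icc γ β := ⟨hγβ.le, le_rfl⟩
    -- Backward uniqueness: a strict gap at `γ` would survive to `β`, where the two angles agree.
    have hγ : θ γ = η γ + ((i - j : ℤ) : ℝ) * π := by
      rcases lt_trichotomy (θ γ) (η γ + ((i - j : ℤ) : ℝ) * π) with h | h | h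
      · exact absurd hβ.symm ((hθ'.le_of_le hA hA0 hW le_rfl hη' h.le β hmem).2 h).ne
      · exact h
      · exact absurd hβ ((hη'.le_of_le hA hA0 hW le_rfl hθ' h.le β hmem).2 h).ne
    rw [hγ, hη0, add_sub_cancel_left, sin_int_mul_pi]

/-! ### Merged lists and eigenvalue lists -/

/-- If `x < σ i`, the `k + k'` chosen members would all occupy positions below `i`, which are too
few. -/
theorem NeumannDecoupling.IsMergedList.le_of_lt {l m σ : ℕ → ℝ} (h : IsMergedList l m σ) {x : ℝ}
    {k k' : ℕ} (hl : ∀ j < k, l j ≤ x) (hm : ∀ j < k', m j ≤ x) {i : ℕ} (hi : i < k + k') :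
    σ i ≤ x := by
  obtain ⟨hmono, e, he⟩ := h
  by_contra! hlt
  have hsub : ((Finset.range k).disjSum (Finset.range k')).map e.symm.toEmbedding
      ⊆ Finset.range i := by
    intro j hj
    obtain ⟨s, hs, rfl⟩ := Finset.mem_map.1 hj
    have hle : σ (e.symm s) ≤ x := by
      rw [he, Equiv.apply_symm_apply]
      rcases s with s | s
      · exact hl s (by simpa using hs)
      · exact hm s (by simpa using hs)
    rw [Finset.mem_range]
    exact hmono.reflect_lt (hle.trans_lt hlt)
  have := Finset.card_le_card hsub
  simp at this
  omega

/-- If `σ i < x`, the positions `0, …, i` would inject into the `k + k' ≤ i` members allowed to be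
below `x`. -/
theorem NeumannDecoupling.IsMergedList.le_of_le {l m σ : ℕ → ℝ} (h : IsMergedList l m σ) {x : ℝ}
    {k k' : ℕ} (hl : ∀ j, k ≤ j → x ≤ l j) (hm : ∀ j, k' ≤ j → x ≤ m j) {i : ℕ}
    (hi : k + k' ≤ i) : x ≤ σ i := by
  obtain ⟨hmono, e, he⟩ := h
  by_contra! hlt
  have hsub : (Finset.range (i + 1)).map e.toEmbedding
      ⊆ (Finset.range k).disjSum (Finset.range k') := by
    intro s hs
    obtain ⟨j, hj, rfl⟩ := Finset.mem_map.1 hs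
    have hle : σ j < x := (hmono (by simpa [Nat.lt_succ_iff] using hj)).trans_lt hlt
    rw [he] at hle
    rw [Equiv.coe_toEmbedding]
    rcases hes : e j with s | s
    · rw [hes] at hle
      simp only [Finset.inl_mem_disjSum, Finset.mem_range]
      by_contra! h
      exact absurd (hl s h) (not_le.2 hle)
    · rw [hes] at hle
      simp only [Finset.inr_mem_disjSum, Finset.mem_range]
      by_contra! h
      exact absurd (hm s h) (not_le.2 hle)
  have := Finset.card_le_card hsub
  simp at this
  omega

theorem nonempty_orderIso_nat_of_finite_Iic {ι : Type*} [LinearOrder ι] [Infinite ι]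
    (hfin : ∀ t : ι, (Iic t).Finite) : Nonempty (ι ≃o ℕ) := by
  let _ : LocallyFiniteOrder ι :=
    LocallyFiniteOrder.ofFiniteIcc fun a b => (hfin b).subset fun _ h => h.2
  let _ : SuccOrder ι := LinearLocallyFiniteOrder.succOrder _
  let _ : PredOrder ι := LinearLocallyFiniteOrder.predOrder _
  have : NoMaxOrder ι := by
    refine ⟨fun t => ?_⟩
    by_contra! h
    exact infinite_univ ((hfin t).subset fun s _ => h s)
  obtain ⟨b, hb⟩ : ∃ b : ι, ∀ s, b ≤ s := by
    obtain ⟨t⟩ : Nonempty ι := inferInstance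
    obtain ⟨b, hb, hmin⟩ := Set.exists_min_image _ id (hfin t) ⟨t, le_refl _⟩
    refine ⟨b, fun s => ?_⟩
    rcases le_total s t with h | h
    · exact hmin s h
    · exact le_trans hb h
  let _ : OrderBot ι := { bot := b, bot_le := hb }
  exact ⟨orderIsoNatOfLinearSuccPredArch⟩

theorem exists_isMergedList {l m : ℕ → ℝ} (hl : ∀ x, {j | l j ≤ x}.Finite)
    (hm : ∀ x, {j | m j ≤ x}.Finite) : ∃ σ, IsMergedList l m σ := by
  -- Order labels by value and break ties by the label itself, so equal values stay separate.
  -- Initial segments are finite, hence the order type is that of `ℕ`.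
  let f : ℕ ⊕ ℕ → ℝ ×ₗ (ℕ ⊕ₗ ℕ) := fun s => toLex (Sum.elim l m s, toLex s)
  have hf : Function.Injective f := fun s t h =>
    congrArg (fun p : ℝ ×ₗ (ℕ ⊕ₗ ℕ) => ofLex (ofLex p).2) h
  let e₀ : ℕ ⊕ ℕ ≃ range f := Equiv.ofInjective f hf
  have hval : ∀ s t : ℕ ⊕ ℕ, e₀ s ≤ e₀ t → Sum.elim l m s ≤ Sum.elim l m t := by
    intro s t hst
    have h1 : f s ≤ f t := hst
    rw [Prod.Lex.le_iff] at h1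
    rcases h1 with h1 | h1
    · exact h1.le
    · exact h1.1.le
  have hfin : ∀ t : range f, (Iic t).Finite := by
    intro t
    refine ((((hl (Sum.elim l m (e₀.symm t))).image Sum.inl).union
      ((hm (Sum.elim l m (e₀.symm t))).image Sum.inr)).image e₀).subset
      fun s (hs : s ≤ t) => ⟨e₀.symm s, ?_, e₀.apply_symm_apply s⟩
    have := hval (e₀.symm s) (e₀.symm t) (by simpa only [e₀.apply_symm_apply] using hs)
    rcases hs' : e₀.symm s with s' | s'
    · exact Or.inl ⟨s', by simpa [hs'] using this, rfl⟩
    · exact Or.inr ⟨s', by simpa [hs'] using this, rfl⟩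
  have : Infinite (range f) := Infinite.of_injective e₀ e₀.injective
  obtain ⟨e⟩ := nonempty_orderIso_nat_of_finite_Iic hfin
  refine ⟨fun i => Sum.elim l m (e₀.symm (e.symm i)), fun i j hij => hval _ _ ?_,
    e.symm.toEquiv.trans e₀.symm, fun i => rfl⟩
  simpa only [e₀.apply_symm_apply] using e.symm.monotone hij

/-- Both lists realise the same multiplicities. These are at most one since `ν₀` is injective, so
`ν` is strictly monotone too, and strictly monotone sequences are determined by their range. -/
theorem NeumannDecoupling.IsEigenvalueList.eq_of_strictMono {E : Type} [AddCommGroup E] [Module ℂ E]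
    {T : E →ₗ.[ℂ] E} {ν ν₀ : ℕ → ℝ} (h : IsEigenvalueList T ν) (h₀ : IsEigenvalueList T ν₀)
    (hmono : StrictMono ν₀) : ν = ν₀ := by
  have hcard : ∀ x : ℝ, {i | ν i = x}.encard = {i | ν₀ i = x}.encard := by
    intro x
    have h1 := ((h.2 x).2).trans (h₀.2 x).2.symm
    simpa only [Complex.ofReal_inj] using h1
  have hinj : Function.Injective ν := by
    intro i j hij
    have h1 : {k | ν k = ν j}.encard ≤ 1 := by
      rw [hcard, encard_le_one_iff]
      intro a b ha hb
      exact hmono.injective (Eq.trans ha hb.symm)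
    exact encard_le_one_iff.1 h1 i j hij rfl
  have hν : StrictMono ν := h.1.strictMono_of_injective hinj
  rw [← hν.range_inj hmono]
  ext x
  have h1 : ∀ f : ℕ → ℝ, x ∈ range f ↔ {i | f i = x}.encard ≠ 0 := fun f => by
    rw [encard_ne_zero]; rfl
  rw [h1, h1, hcard]

/-! ### The first-order system -/

/-- The first order system equivalent to `-(a u')' + V u = z u`, where `A = 1 / a`, `W' = V` and
`q = a u' - W u`. -/
def IsQuasiSolution (A W : ℝ → ℝ) (z : ℂ) (c d : ℝ) (u q : ℝ → ℂ) : Prop :=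
  ∀ x ∈ Icc c d, HasDerivWithinAt u (A x * (q x + W x * u x)) (Icc c d) x ∧
    HasDerivWithinAt q (-(z * u x) - W x * (A x * (q x + W x * u x))) (Icc c d) x

theorem AbsolutelyContinuousOnInterval.congr_of_eqOn {X : Type*} [PseudoMetricSpace X]
    {f g : ℝ → X} {a b : ℝ} (hf : AbsolutelyContinuousOnInterval f a b) (h : EqOn f g (uIcc a b)) :
    AbsolutelyContinuousOnInterval g a b := by
  rw [absolutelyContinuousOnInterval_iff] at hf ⊢
  intro ε hε
  obtain ⟨δ, hδ, H⟩ := hf ε hε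
  refine ⟨δ, hδ, fun E hE hlt => ?_⟩
  have := H E hE hlt
  rwa [Finset.sum_congr rfl fun i hi => by
    rw [h (hE.1 i hi).1, h (hE.1 i hi).2]] at this

theorem absolutelyContinuousOnInterval_of_hasDerivWithinAt {E : Type*} [NormedAddCommGroup E]
    [NormedSpace ℝ E] {u u' : ℝ → E} {c d : ℝ} (hcd : c < d)
    (hu : ∀ x ∈ Icc c d, HasDerivWithinAt u (u' x) (Icc c d) x) (hc : ContinuousOn u' (Icc c d)) :
    AbsolutelyContinuousOnInterval u c d := by
  obtain ⟨C, hC⟩ := isCompact_Icc.exists_bound_of_continuousOn hc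
  refine LipschitzOnWith.absolutelyContinuousOnInterval (K := C.toNNReal) ?_
  rw [uIcc_of_le hcd.le]
  exact (convex_Icc c d).lipschitzOnWith_of_nnnorm_hasDerivWithin_le hu fun x hx => by
    rw [← NNReal.coe_le_coe, coe_nnnorm]
    exact (hC x hx).trans (le_coe_toNNReal C)

theorem exists_hasDerivAt_of_continuousOn {E : Type*} [NormedAddCommGroup E]
    [NormedSpace ℝ E] [CompleteSpace E] {g : ℝ → E} {c d : ℝ} (hcd : c ≤ d)
    (hg : ContinuousOn g (Icc c d)) :
    ∃ R : ℝ → E, ∀ x ∈ Icc c d, HasDerivAt R (g x) x := by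
  have hc : Continuous (IccExtend hcd ((Icc c d).domRestrict g)) :=
    (continuousOn_iff_continuous_domRestrict.1 hg).Icc_extend'
  refine ⟨_, fun x hx => (intervalIntegral.integral_hasDerivAt_right
    (hc.intervalIntegrable c x) (hc.stronglyMeasurableAtFilter _ _) hc.continuousAt).congr_deriv ?_⟩
  rw [IccExtend_of_mem _ _ hx, domRestrict_apply]

theorem ae_imp_of_ae_restrict_Ioo {c d : ℝ} (hcd : c ≤ d) {p : ℝ → Prop}
    (h : ∀ᵐ x ∂(volume.restrict (Ioo c d)), p x) : ∀ᵐ x, x ∈ uIcc c d → x ∈ Ioo c d ∧ p x := by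
  rw [ae_restrict_iff' measurableSet_Ioo] at h
  have h1 : ∀ᵐ x : ℝ, x ≠ c := by simp [ae_iff, measure_singleton]
  have h2 : ∀ᵐ x : ℝ, x ≠ d := by simp [ae_iff, measure_singleton]
  filter_upwards [h, h1, h2] with x hx hxc hxd hm
  rw [uIcc_of_le hcd] at hm
  have hm' : x ∈ Ioo c d := ⟨lt_of_le_of_ne hm.1 hxc.symm, lt_of_le_of_ne hm.2 hxd⟩
  exact ⟨hm', hx hm'⟩

section System

variable {A W : ℝ → ℝ} {z : ℂ} {c d : ℝ} {u q : ℝ → ℂ}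

theorem IsQuasiSolution.continuousOn_left (h : IsQuasiSolution A W z c d u q) :
    ContinuousOn u (Icc c d) := fun x hx => (h x hx).1.continuousWithinAt

theorem IsQuasiSolution.continuousOn_right (h : IsQuasiSolution A W z c d u q) :
    ContinuousOn q (Icc c d) := fun x hx => (h x hx).2.continuousWithinAt

theorem IsQuasiSolution.sub_smul (h : IsQuasiSolution A W z c d u q) {v p : ℝ → ℂ}
    (h' : IsQuasiSolution A W z c d v p) (k : ℂ) :
    IsQuasiSolution A W z c d (fun x => u x - k * v x) (fun x => q x - k * p x) := fun x hx =>
  ⟨((h x hx).1.sub ((h' x hx).1.const_mul k)).congr_deriv (by ring),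
    ((h x hx).2.sub ((h' x hx).2.const_mul k)).congr_deriv (by ring)⟩

theorem IsQuasiSolution.eq_zero (hA : Continuous A) (hW : Continuous W)
    (h : IsQuasiSolution A W z c d u q) (hu : u c = 0) (hq : q c = 0) :
    ∀ x ∈ Icc c d, u x = 0 ∧ q x = 0 := by
  obtain ⟨E, hE⟩ := (isCompact_Icc (a := c) (b := d)).exists_bound_of_continuousOn hA.continuousOn
  obtain ⟨M, hM⟩ := (isCompact_Icc (a := c) (b := d)).exists_bound_of_continuousOn hW.continuousOn
  have key := eq_zero_of_abs_deriv_le_mul_abs_self_of_eq_zero_right (f := fun x => (u x, q x))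
    (f' := fun x => ((A x * (q x + W x * u x) : ℂ),
      (-(z * u x) - W x * (A x * (q x + W x * u x)) : ℂ)))
    (K := E * (1 + M) + (‖z‖ + M * (E * (1 + M)))) (a := c) (b := d)
    (h.continuousOn_left.prodMk h.continuousOn_right) (fun x hx => ?_) (by simp [hu, hq])
    (fun x hx => ?_)
  · intro x hx
    have := key x hx
    simpa using this
  · have hm := Icc_mem_nhdsGE_of_mem hx
    have hx' := Ico_subset_Icc_self hx
    exact ((h x hx').1.mono_of_mem_nhdsWithin hm).prodMk ((h x hx').2.mono_of_mem_nhdsWithin hm)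
  · have hx' := Ico_subset_Icc_self hx
    have hE' := hE x hx'
    have hM' := hM x hx'
    have hE0 : 0 ≤ E := (norm_nonneg _).trans hE'
    have hM0 : 0 ≤ M := (norm_nonneg _).trans hM'
    set N := ‖(u x, q x)‖
    have h1 : ‖u x‖ ≤ N := norm_fst_le (u x, q x)
    have h2 : ‖q x‖ ≤ N := norm_snd_le (u x, q x)
    have hN : 0 ≤ N := norm_nonneg _
    have h3 : ‖(A x * (q x + W x * u x) : ℂ)‖ ≤ E * (1 + M) * N := by
      rw [norm_mul, Complex.norm_real]
      calc ‖A x‖ * ‖q x + W x * u x‖ ≤ E * (N + M * N) := by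
            gcongr
            refine (norm_add_le _ _).trans (add_le_add h2 ?_)
            rw [norm_mul, Complex.norm_real]
            gcongr
        _ = _ := by ring
    have h4 : ‖(-(z * u x) - W x * (A x * (q x + W x * u x)) : ℂ)‖
        ≤ (‖z‖ + M * (E * (1 + M))) * N := by
      refine (norm_sub_le _ _).trans ?_
      rw [norm_neg, norm_mul, norm_mul (W x : ℂ), Complex.norm_real]
      calc ‖z‖ * ‖u x‖ + ‖W x‖ * ‖(A x * (q x + W x * u x) : ℂ)‖
          ≤ ‖z‖ * N + M * (E * (1 + M) * N) := by gcongr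
        _ = _ := by ring
    refine (Prod.norm_def _).trans_le (max_le (h3.trans ?_) (h4.trans ?_))
    · exact mul_le_mul_of_nonneg_right (le_add_of_nonneg_right (by positivity)) hN
    · exact mul_le_mul_of_nonneg_right (le_add_of_nonneg_left (by positivity)) hN

/-- A Prüfer angle gives rise to a real solution of the system. -/
theorem IsPruferAngle.exists_isQuasiSolution (hA : Continuous A) (hW : Continuous W) {lam : ℝ}
    (hcd : c ≤ d) {θ : ℝ → ℝ} (hθ : IsPruferAngle A W lam c d θ) :
    ∃ r : ℝ → ℝ, (∀ x, 0 < r x) ∧ IsQuasiSolution A W lam c d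
      (fun x => ((r x * sin (θ x) : ℝ) : ℂ)) (fun x => ((r x * cos (θ x) : ℝ) : ℂ)) := by
  have hθc := hθ.continuousOn
  -- The integrand is `r' / r`, so `r = exp R` is a positive radius.
  obtain ⟨R, hR⟩ := exists_hasDerivAt_of_continuousOn hcd (g := fun x =>
    sin (θ x) * (A x * (cos (θ x) + W x * sin (θ x))) + cos (θ x) * (-(lam * sin (θ x))
      - W x * (A x * (cos (θ x) + W x * sin (θ x))))) (by fun_prop)
  refine ⟨fun x => exp (R x), fun x => exp_pos _, fun x hx => ?_⟩
  have h1 := hR x hx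
  have h3 := h1.exp.hasDerivWithinAt (s := Icc c d)
  have h4 := hθ x hx
  have hsc := sin_sq_add_cos_sq (θ x)
  constructor
  · refine ((h3.mul h4.sin).congr_deriv ?_).ofReal_comp.congr_deriv
      (f' := ((A x * (exp (R x) * cos (θ x) + W x * (exp (R x) * sin (θ x))) : ℝ) : ℂ))
      (by push_cast; ring)
    simp only [pruferField]
    linear_combination (exp (R x) * (A x * (cos (θ x) + W x * sin (θ x)))) * hsc
  · refine ((h3.mul h4.cos).congr_deriv ?_).ofReal_comp.congr_deriv
      (f' := ((-(lam * (exp (R x) * sin (θ x))) - W x *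
        (A x * (exp (R x) * cos (θ x) + W x * (exp (R x) * sin (θ x)))) : ℝ) : ℂ))
      (by push_cast; ring)
    simp only [pruferField]
    linear_combination (-(exp (R x) * (lam * sin (θ x)
      + W x * (A x * (cos (θ x) + W x * sin (θ x)))))) * hsc

/-- Symmetry of the boundary value problem: there are no non-real eigenvalues. -/
theorem IsQuasiSolution.eq_zero_of_im_ne_zero (h : IsQuasiSolution A W z c d u q) (hz : z.im ≠ 0)
    (hc : q c + W c * u c = 0) (hd : q d + W d * u d = 0) : ∀ x ∈ Ioo c d, u x = 0 := by
  -- `G` is the imaginary part of `q` times the conjugate of `u`. It vanishes at both ends because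
  -- `W` is real, while `z.im * G` is antitone; so it is identically zero, and so is its derivative
  -- `-(z.im)² |u|²`.
  set G : ℝ → ℝ := fun x => (q x).im * (u x).re - (q x).re * (u x).im with hG
  have hG' : ∀ x ∈ Icc c d, HasDerivWithinAt G (-(z.im * Complex.normSq (u x))) (Icc c d) x := by
    intro x hx
    have hre : ∀ {f : ℝ → ℂ} {f' : ℂ}, HasDerivWithinAt f f' (Icc c d) x →
        HasDerivWithinAt (fun y => (f y).re) f'.re (Icc c d) x := fun hf =>
      (Complex.reCLM.hasFDerivAt.comp_hasDerivWithinAt x hf)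
    have him : ∀ {f : ℝ → ℂ} {f' : ℂ}, HasDerivWithinAt f f' (Icc c d) x →
        HasDerivWithinAt (fun y => (f y).im) f'.im (Icc c d) x := fun hf =>
      (Complex.imCLM.hasFDerivAt.comp_hasDerivWithinAt x hf)
    have h1 := (h x hx).1
    have h2 := (h x hx).2
    refine (((him h2).mul (hre h1)).sub ((hre h2).mul (him h1))).congr_deriv ?_
    simp only [Complex.sub_re, Complex.sub_im, Complex.neg_re, Complex.neg_im, Complex.mul_re,
      Complex.mul_im, Complex.add_re, Complex.add_im, Complex.ofReal_re, Complex.ofReal_im,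
      Complex.normSq_apply]
    ring
  have hend : ∀ x, q x + W x * u x = 0 → G x = 0 := by
    intro x hx
    have h1 : q x = -(W x * u x) := eq_neg_of_add_eq_zero_left hx
    simp only [hG, h1, Complex.neg_re, Complex.neg_im, Complex.mul_re, Complex.mul_im,
      Complex.ofReal_re, Complex.ofReal_im]
    ring
  have hGz : ∀ x ∈ Icc c d, z.im * G x = 0 := by
    have hanti : AntitoneOn (fun x => z.im * G x) (Icc c d) := by
      refine antitoneOn_of_hasDerivWithinAt_nonpos (convex_Icc c d)
        (fun x hx => ((hG' x hx).const_mul z.im).continuousWithinAt)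
        (fun x hx => ((hG' x (interior_subset hx)).const_mul z.im).mono interior_subset)
        fun x _ => ?_
      have := mul_nonneg (mul_self_nonneg z.im) (Complex.normSq_nonneg (u x))
      linarith
    intro x hx
    have hcd := hx.1.trans hx.2
    have h1 := hanti ⟨le_rfl, hcd⟩ hx hx.1
    have h2 := hanti hx ⟨hcd, le_rfl⟩ hx.2
    simp only [hend c hc, hend d hd, mul_zero] at h1 h2
    exact le_antisymm h1 h2
  intro x hx
  have h1 : HasDerivAt G (-(z.im * Complex.normSq (u x))) x :=
    (hG' x (Ioo_subset_Icc_self hx)).hasDerivAt (Icc_mem_nhds hx.1 hx.2)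
  have h2 : G =ᶠ[𝓝 x] fun _ => 0 := by
    filter_upwards [Icc_mem_nhds hx.1 hx.2] with y hy
    exact (mul_eq_zero.1 (hGz y hy)).resolve_left hz
  have h3 := h1.unique ((hasDerivAt_const x (0 : ℝ)).congr_of_eventuallyEq h2)
  rw [neg_eq_zero, mul_eq_zero, Complex.normSq_eq_zero] at h3
  exact h3.resolve_left hz

end System

/-! ### From the operator to the system and back -/

/-- `A = 1 / a` and `W` is a primitive of `V` on `[c, d]`. -/
structure IsRegularization (a V A W : ℝ → ℝ) (c d : ℝ) : Prop where
  contDiffOn : ContDiffOn ℝ 1 a (Icc c d)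
  pos : ∀ x ∈ Icc c d, 0 < a x
  continuous_left : Continuous A
  left_pos : ∀ x, 0 < A x
  left_eq : ∀ x ∈ Icc c d, A x = (a x)⁻¹
  continuous_right : Continuous W
  absolutelyContinuous : AbsolutelyContinuousOnInterval W c d
  ae_hasDerivAt : ∀ᵐ x, x ∈ Ioo c d → HasDerivAt W (V x) x

/-- One pair `A`, `W` serves all three intervals, so the Neumann angle at `γ` is the same from both
sides. -/
theorem IsRegularization.mono {a V A W : ℝ → ℝ} {c d c' d' : ℝ}
    (h : IsRegularization a V A W c d) (hc : c ≤ c') (hcd : c' ≤ d') (hd : d' ≤ d) :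
    IsRegularization a V A W c' d' where
  contDiffOn := h.contDiffOn.mono (Icc_subset_Icc hc hd)
  pos x hx := h.pos x (Icc_subset_Icc hc hd hx)
  continuous_left := h.continuous_left
  left_pos := h.left_pos
  left_eq x hx := h.left_eq x (Icc_subset_Icc hc hd hx)
  continuous_right := h.continuous_right
  absolutelyContinuous := h.absolutelyContinuous.mono (by
    rw [uIcc_of_le hcd, uIcc_of_le (hc.trans (hcd.trans hd))]
    exact Icc_subset_Icc hc hd)
  ae_hasDerivAt := by
    filter_upwards [h.ae_hasDerivAt] with x hx hm using hx (Ioo_subset_Ioo hc hd hm)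

theorem exists_isRegularization {a V : ℝ → ℝ} {α β : ℝ} (hαβ : α < β)
    (ha : ContDiffOn ℝ 1 a (Icc α β)) (ha_pos : ∀ x ∈ Icc α β, 0 < a x)
    (hV : MemLp V ⊤ (volume.restrict (Ioo α β))) :
    ∃ A W, IsRegularization a V A W α β := by
  have hint : Integrable ((Ioo α β).indicator V) :=
    (integrable_indicator_iff measurableSet_Ioo).2 (hV.integrable le_top)
  have hii : ∀ x y, IntervalIntegrable ((Ioo α β).indicator V) volume x y :=
    fun x y => hint.intervalIntegrable
  refine ⟨IccExtend hαβ.le ((Icc α β).domRestrict fun x => (a x)⁻¹),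
    fun x => ∫ t in α..x, (Ioo α β).indicator V t, ha, ha_pos, ?_, ?_, ?_, ?_, ?_, ?_⟩
  · exact (continuousOn_iff_continuous_domRestrict.1
      (ha.continuousOn.inv₀ fun x hx => (ha_pos x hx).ne')).Icc_extend'
  · intro x
    exact inv_pos.2 (ha_pos _ (projIcc α β hαβ.le x).2)
  · intro x hx
    rw [IccExtend_of_mem _ _ hx, domRestrict_apply]
  · exact intervalIntegral.continuous_primitive hii α
  · exact (hii α β).absolutelyContinuousOnInterval_intervalIntegral (by simp)
  · filter_upwards [(hii α β).ae_hasDerivAt_integral] with x hx hm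
    have := hx (by rw [uIcc_of_le hαβ.le]; exact Ioo_subset_Icc_self hm) α (by simp)
    rwa [indicator_of_mem hm] at this

section Regularized

variable {a V A W : ℝ → ℝ} {c d : ℝ}

theorem IsRegularization.absolutelyContinuous_smul (hR : IsRegularization a V A W c d)
    (hcd : c < d) {u u' : ℝ → ℂ} (hu : ∀ x ∈ Icc c d, HasDerivWithinAt u (u' x) (Icc c d) x)
    (hu' : ContinuousOn u' (Icc c d)) :
    AbsolutelyContinuousOnInterval (W • u) c d :=
  hR.absolutelyContinuous.smul (absolutelyContinuousOnInterval_of_hasDerivWithinAt hcd hu hu')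

/-- The eigenvalue equation for a Neumann function gives a solution of the first order system. -/
theorem IsRegularization.isQuasiSolution (hR : IsRegularization a V A W c d) (hcd : c < d)
    {u h : ℝ → ℂ} {z : ℂ} (hu : IsNeumannFunction c d u) (hh : IsSturmLiouvilleImage a V c d u h)
    (hz : h =ᵐ[volume.restrict (Ioo c d)] fun x => z * u x) :
    IsQuasiSolution A W z c d u (fun x => a x * derivWithin u (Icc c d) x - W x * u x) := by
  have hdu : ∀ x ∈ Icc c d, HasDerivWithinAt u (derivWithin u (Icc c d) x) (Icc c d) x :=
    fun x hx => (hu.differentiableOn x hx).hasDerivWithinAt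
  have hI : uIcc c d = Icc c d := uIcc_of_le hcd.le
  have hdc : ContinuousOn (derivWithin u (Icc c d)) (Icc c d) := by
    simpa [hI] using hu.absolutelyContinuous.continuousOn
  have haA : ∀ x ∈ Icc c d, (A x : ℂ) * (a x : ℂ) = 1 := fun x hx => by
    rw [hR.left_eq x hx, ← Complex.ofReal_mul, inv_mul_cancel₀ (hR.pos x hx).ne',
      Complex.ofReal_one]
  set q : ℝ → ℂ := fun x => a x * derivWithin u (Icc c d) x - W x * u x with hq
  set g : ℝ → ℂ := fun x => -(z * u x) - W x * (A x * (q x + W x * u x)) with hg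
  have huc : ContinuousOn u (Icc c d) := hu.differentiableOn.continuousOn
  have hac := hR.contDiffOn.continuousOn
  have hWc := hR.continuous_right
  have hAc := hR.continuous_left
  have hqc : ContinuousOn q (Icc c d) := by
    simp only [hq]
    exact ((Complex.continuous_ofReal.comp_continuousOn hac).mul hdc).sub
      ((Complex.continuous_ofReal.comp hWc).continuousOn.mul huc)
  have hgc : ContinuousOn g (Icc c d) := by
    simp only [hg]
    fun_prop
  have hqac : AbsolutelyContinuousOnInterval q c d := by
    have h1 : AbsolutelyContinuousOnInterval a c d :=
      ContDiffOn.absolutelyContinuousOnInterval (by rw [hI]; exact hR.contDiffOn)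
    refine ((h1.smul hu.absolutelyContinuous).sub
      (hR.absolutelyContinuous_smul hcd hdu hdc)).congr_of_eqOn fun x _ => ?_
    simp [hq]
  -- The equation holds only almost everywhere, but in `q'` the term `V u` cancels and leaves the
  -- continuous function `g`. As `q - R` is absolutely continuous with derivative zero a.e., it is
  -- constant, so `q' = g` everywhere.
  obtain ⟨R, hRd⟩ := exists_hasDerivAt_of_continuousOn hcd.le hgc
  have hRac := absolutelyContinuousOnInterval_of_hasDerivWithinAt hcd
    (fun x hx => (hRd x hx).hasDerivWithinAt) hgc
  have hconst := (hqac.sub hRac).const_of_ae_hasDerivAt_zero (by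
    filter_upwards [ae_imp_of_ae_restrict_Ioo hcd.le (hh.and hz), hR.ae_hasDerivAt]
      with x hx hWx hm
    obtain ⟨hxm, h1, h2⟩ := hx hm
    have hxm' := Ioo_subset_Icc_self hxm
    have h3 := (hWx hxm).ofReal_comp.mul
      ((hdu x hxm').hasDerivAt (Icc_mem_nhds hxm.1 hxm.2))
    refine ((h1.sub h3).sub (hRd x hxm')).congr_deriv ?_
    have h4 : (A x : ℂ) * (a x * derivWithin u (Icc c d) x) = derivWithin u (Icc c d) x := by
      rw [← mul_assoc, haA x hxm', one_mul]
    simp only [hg, hq, h2]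
    linear_combination (W x : ℂ) * h4)
  obtain ⟨C, hC⟩ := hconst
  intro x hx
  refine ⟨(hdu x hx).congr_deriv ?_, ?_⟩
  · simp only [hq]
    rw [sub_add_cancel, ← mul_assoc, haA x hx, one_mul]
  · have h1 : ∀ y ∈ Icc c d, q y = R y + C := fun y hy => by
      rw [← hC y (by rwa [hI])]; simp
    exact (((hRd x hx).hasDerivWithinAt).add_const C).congr h1 (h1 x hx)

/-- Solutions of the first order system with Neumann conditions are eigenfunctions. -/
theorem IsRegularization.isNeumannFunction (hR : IsRegularization a V A W c d) (hcd : c < d)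
    {u q : ℝ → ℂ} {z : ℂ} (hs : IsQuasiSolution A W z c d u q) (hc : q c + W c * u c = 0)
    (hd : q d + W d * u d = 0) :
    IsNeumannFunction c d u ∧ IsSturmLiouvilleImage a V c d u fun x => z * u x := by
  have hI : uIcc c d = Icc c d := uIcc_of_le hcd.le
  have hder : ∀ x ∈ Icc c d, derivWithin u (Icc c d) x = A x * (q x + W x * u x) := fun x hx =>
    (hs x hx).1.derivWithin (uniqueDiffOn_Icc hcd x hx)
  have haA : ∀ x ∈ Icc c d, (a x : ℂ) * (A x : ℂ) = 1 := fun x hx => by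
    rw [hR.left_eq x hx, ← Complex.ofReal_mul, mul_inv_cancel₀ (hR.pos x hx).ne',
      Complex.ofReal_one]
  have hWc := hR.continuous_right
  have hAc := hR.continuous_left
  have huc := hs.continuousOn_left
  have hqc := hs.continuousOn_right
  refine ⟨⟨fun x hx => (hs x hx).1.differentiableWithinAt, ?_, ?_, ?_⟩, ?_⟩
  · have h1 : AbsolutelyContinuousOnInterval (fun x => (a x)⁻¹) c d :=
      ContDiffOn.absolutelyContinuousOnInterval (by
        rw [hI]; exact hR.contDiffOn.inv fun x hx => (hR.pos x hx).ne')
    have h2 := absolutelyContinuousOnInterval_of_hasDerivWithinAt hcd (fun x hx => (hs x hx).2)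
      (by fun_prop)
    have h3 := hR.absolutelyContinuous_smul hcd (fun x hx => (hs x hx).1) (by fun_prop)
    refine (h1.smul (h2.add h3)).congr_of_eqOn fun x hx => ?_
    rw [hI] at hx
    rw [hder x hx, hR.left_eq x hx]
    simp [mul_add]
  · rw [hder c ⟨le_rfl, hcd.le⟩, hc, mul_zero]
  · rw [hder d ⟨hcd.le, le_rfl⟩, hd, mul_zero]
  · rw [IsSturmLiouvilleImage, ae_restrict_iff' measurableSet_Ioo]
    filter_upwards [hR.ae_hasDerivAt] with x hWx hx
    have hx' := Ioo_subset_Icc_self hx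
    have hn := Icc_mem_nhds hx.1 hx.2
    have h1 := ((hs x hx').2.hasDerivAt hn).add
      ((hWx hx).ofReal_comp.mul ((hs x hx').1.hasDerivAt hn))
    refine (h1.congr_deriv ?_).congr_of_eventuallyEq ?_
    · ring
    · filter_upwards [hn] with y hy
      rw [hder y hy, ← mul_assoc, haA y hy, one_mul]
      simp

/-- Eigenfunctions of the Neumann operator in terms of the first order system. -/
theorem IsRegularization.mem_eigenspace_iff (hR : IsRegularization a V A W c d) (hcd : c < d)
    (z : ℂ) (f : L2 c d) : f ∈ eigenspace (neumannOperator a V c d) z ↔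
      ∃ u q : ℝ → ℂ, IsQuasiSolution A W z c d u q ∧ q c + W c * u c = 0 ∧ q d + W d * u d = 0 ∧
        f =ᵐ[volume.restrict (Ioo c d)] u := by
  have hmem : f ∈ eigenspace (neumannOperator a V c d) z ↔ (f, z • f) ∈ neumannGraph a V c d := by
    rw [← neumannOperator_graph]; rfl
  rw [hmem]
  constructor
  · rintro ⟨u, hu, hfu, hh⟩
    have hz : (z • f : L2 c d) =ᵐ[volume.restrict (Ioo c d)] fun x => z * u x := by
      filter_upwards [Lp.coeFn_smul z f, hfu] with x h1 h2
      rw [h1, Pi.smul_apply, h2, smul_eq_mul]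
    refine ⟨u, _, hR.isQuasiSolution hcd hu hh hz, ?_, ?_, hfu⟩
    · simp [hu.deriv_left]
    · simp [hu.deriv_right]
  · rintro ⟨u, q, hs, hc, hd, hfu⟩
    obtain ⟨h1, h2⟩ := hR.isNeumannFunction hcd hs hc hd
    refine ⟨u, h1, hfu, ?_⟩
    rw [IsSturmLiouvilleImage] at h2 ⊢
    filter_upwards [h2, Lp.coeFn_smul z f, hfu] with x h3 h4 h5
    have h6 : ((f, z • f) : L2 c d × L2 c d).2 x = z * u x := by
      rw [h4, Pi.smul_apply, h5, smul_eq_mul]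
    rw [h6]
    exact h3

end Regularized

/-! ### Neumann angles and the spectrum -/

/-- The angle, in `(0, π)`, of the Neumann condition `q + W u = 0`. -/
noncomputable def neumannAngle (W : ℝ → ℝ) (x : ℝ) : ℝ := π / 2 + arctan (W x)

theorem neumannAngle_mem (W : ℝ → ℝ) (x : ℝ) : neumannAngle W x ∈ Ioo 0 π := by
  have h1 := neg_pi_div_two_lt_arctan (W x)
  have h2 := arctan_lt_pi_div_two (W x)
  constructor <;> simp only [neumannAngle] <;> linarith

/-- The Neumann angle `κ` satisfies `cos κ = -W sin κ`, so `sin κ` factors out of the subtraction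
formula. -/
theorem sin_sub_neumannAngle (W : ℝ → ℝ) (x t : ℝ) :
    sin (t - neumannAngle W x) = -(sin (neumannAngle W x) * (cos t + W x * sin t)) := by
  have h1 : cos (neumannAngle W x) = -(W x * sin (neumannAngle W x)) := by
    rw [neumannAngle, add_comm, cos_add_pi_div_two, sin_add_pi_div_two, ← tan_mul_cos
      (cos_arctan_pos _).ne', tan_arctan]
  rw [sin_sub, h1]
  ring

theorem cos_add_mul_sin_eq_zero_iff (W : ℝ → ℝ) (x t : ℝ) :
    cos t + W x * sin t = 0 ↔ sin (t - neumannAngle W x) = 0 := by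
  rw [sin_sub_neumannAngle, neg_eq_zero, mul_eq_zero]
  exact ⟨Or.inr, fun h => h.resolve_left (sin_pos_of_mem_Ioo (neumannAngle_mem W x)).ne'⟩

section Spectrum

variable {a V A W : ℝ → ℝ} {c d : ℝ}

/-- A solution of the system satisfying the left Neumann condition is a multiple of the one given
by the Prüfer angle. -/
theorem IsQuasiSolution.exists_eq_mul (hA : Continuous A) (hW : Continuous W) {z : ℂ}
    {u q : ℝ → ℂ} (h : IsQuasiSolution A W z c d u q) (hc : q c + W c * u c = 0)
    {r θ : ℝ → ℝ} (hr : ∀ x, 0 < r x) (hθ : θ c = neumannAngle W c)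
    (hs : IsQuasiSolution A W z c d
      (fun x => ((r x * sin (θ x) : ℝ) : ℂ)) (fun x => ((r x * cos (θ x) : ℝ) : ℂ))) :
    ∃ k : ℂ, ∀ x ∈ Icc c d, u x = k * (r x * sin (θ x) : ℝ) ∧ q x = k * (r x * cos (θ x) : ℝ) := by
  have hφ : r c * sin (θ c) ≠ 0 := by
    rw [hθ]
    exact (mul_pos (hr c) (sin_pos_of_mem_Ioo (neumannAngle_mem W c))).ne'
  have hφ' : ((r c * sin (θ c) : ℝ) : ℂ) ≠ 0 := Complex.ofReal_ne_zero.2 hφ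
  have hcos : r c * cos (θ c) = -(W c * (r c * sin (θ c))) := by
    have : cos (θ c) + W c * sin (θ c) = 0 := by
      rw [cos_add_mul_sin_eq_zero_iff, hθ, sub_self, sin_zero]
    linear_combination r c * this
  -- Matches `u` at `c`; the shared left Neumann condition then matches `q`, and uniqueness for the
  -- system does the rest.
  set k : ℂ := u c / (r c * sin (θ c) : ℝ) with hk
  have huk : u c = k * (r c * sin (θ c) : ℝ) := (div_mul_cancel₀ _ hφ').symm
  refine ⟨k, fun x hx => ?_⟩
  have := (h.sub_smul hs k).eq_zero hA hW (by rw [← huk, sub_self]) (by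
    rw [hcos]
    push_cast at huk ⊢
    linear_combination hc - (W c : ℂ) * huk) x hx
  exact ⟨sub_eq_zero.1 this.1, sub_eq_zero.1 this.2⟩

theorem IsRegularization.eigenspace_eq_bot_of_im_ne_zero (hR : IsRegularization a V A W c d)
    (hcd : c < d) {z : ℂ} (hz : z.im ≠ 0) : eigenspace (neumannOperator a V c d) z = ⊥ := by
  rw [Submodule.eq_bot_iff]
  intro f hf
  obtain ⟨u, q, hs, hc, hd, hfu⟩ := (hR.mem_eigenspace_iff hcd z f).1 hf
  rw [Lp.eq_zero_iff_ae_eq_zero]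
  filter_upwards [hfu, ae_restrict_mem measurableSet_Ioo] with x hx hm
  rw [hx]
  exact hs.eq_zero_of_im_ne_zero hz hc hd x hm

/-- Eigenvalues are simple, and are detected by the Prüfer angle. -/
theorem IsRegularization.finrank_eigenspace (hR : IsRegularization a V A W c d) (hcd : c < d)
    {lam : ℝ} {θ : ℝ → ℝ} (hθ0 : θ c = neumannAngle W c) (hθ : IsPruferAngle A W lam c d θ) :
    FiniteDimensional ℂ (eigenspace (neumannOperator a V c d) lam) ∧
      (sin (θ d - neumannAngle W d) = 0 →
        Module.finrank ℂ (eigenspace (neumannOperator a V c d) lam) = 1) ∧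
      (sin (θ d - neumannAngle W d) ≠ 0 →
        Module.finrank ℂ (eigenspace (neumannOperator a V c d) lam) = 0) := by
  have hA := hR.continuous_left
  have hW := hR.continuous_right
  obtain ⟨r, hr, hs⟩ := hθ.exists_isQuasiSolution hA hW hcd.le
  set φ : ℝ → ℂ := fun x => ((r x * sin (θ x) : ℝ) : ℂ) with hφ
  have hcm : c ∈ Icc c d := ⟨le_rfl, hcd.le⟩
  have hdm : d ∈ Icc c d := ⟨hcd.le, le_rfl⟩
  have hbc : ∀ x, ((r x * cos (θ x) : ℝ) : ℂ) + W x * φ x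
      = ((r x * (cos (θ x) + W x * sin (θ x)) : ℝ) : ℂ) := fun x => by
    simp only [hφ]; push_cast; ring
  rw [Ne, ← cos_add_mul_sin_eq_zero_iff]
  by_cases hend : cos (θ d) + W d * sin (θ d) = 0
  · have hφm : MemLp φ 2 (volume.restrict (Ioo c d)) := by
      obtain ⟨C, hC⟩ := isCompact_Icc.exists_bound_of_continuousOn hs.continuousOn_left
      refine MemLp.of_bound ((hs.continuousOn_left.mono
        Ioo_subset_Icc_self).aestronglyMeasurable measurableSet_Ioo) C ?_
      filter_upwards [ae_restrict_mem measurableSet_Ioo] with x hx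
      exact hC x (Ioo_subset_Icc_self hx)
    have hspan : eigenspace (neumannOperator a V c d) lam = ℂ ∙ hφm.toLp φ := by
      ext f
      rw [hR.mem_eigenspace_iff hcd, Submodule.mem_span_singleton]
      constructor
      · rintro ⟨u, q, hs', hc, hd, hfu⟩
        obtain ⟨k, hk⟩ := hs'.exists_eq_mul hA hW hc hr hθ0 hs
        refine ⟨k, Lp.ext ?_⟩
        filter_upwards [hfu, Lp.coeFn_smul k (hφm.toLp φ), hφm.coeFn_toLp,
          ae_restrict_mem measurableSet_Ioo] with x h1 h2 h3 h4
        rw [h2, h1, Pi.smul_apply, h3, smul_eq_mul, (hk x (Ioo_subset_Icc_self h4)).1]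
      · rintro ⟨k, rfl⟩
        refine ⟨fun x => k * φ x, fun x => k * ((r x * cos (θ x) : ℝ) : ℂ), fun x hx =>
          ⟨((hs x hx).1.const_mul k).congr_deriv (by ring),
            ((hs x hx).2.const_mul k).congr_deriv (by ring)⟩, ?_, ?_, ?_⟩
        · have h1 : cos (θ c) + W c * sin (θ c) = 0 := by
            rw [cos_add_mul_sin_eq_zero_iff, hθ0, sub_self, sin_zero]
          have := hbc c
          rw [h1, mul_zero, Complex.ofReal_zero] at this
          linear_combination k * this
        · have := hbc d
          rw [hend, mul_zero, Complex.ofReal_zero] at this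
          linear_combination k * this
        · filter_upwards [Lp.coeFn_smul k (hφm.toLp φ), hφm.coeFn_toLp] with x h2 h3
          rw [h2, Pi.smul_apply, h3, smul_eq_mul]
    have hne : hφm.toLp φ ≠ 0 := by
      intro h0
      rw [Lp.eq_zero_iff_ae_eq_zero] at h0
      have h1 : φ =ᵐ[volume.restrict (Ioo c d)] fun _ => 0 := hφm.coeFn_toLp.symm.trans h0
      rw [restrict_Ioo_eq_restrict_Icc] at h1
      have h2 := Measure.eqOn_Icc_of_ae_eq volume hcd.ne h1 hs.continuousOn_left
        continuousOn_const hcm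
      simp only [hφ, hθ0, Complex.ofReal_eq_zero] at h2
      exact (mul_pos (hr c) (sin_pos_of_mem_Ioo (neumannAngle_mem W c))).ne' h2
    rw [hspan]
    exact ⟨inferInstance, fun _ => finrank_span_singleton hne, fun h => absurd hend h⟩
  · have hbot : eigenspace (neumannOperator a V c d) lam = ⊥ := by
      rw [Submodule.eq_bot_iff]
      intro f hf
      obtain ⟨u, q, hs', hc, hd, hfu⟩ := (hR.mem_eigenspace_iff hcd _ f).1 hf
      obtain ⟨k, hk⟩ := hs'.exists_eq_mul hA hW hc hr hθ0 hs
      have hk0 : k = 0 := by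
        rw [(hk d hdm).1, (hk d hdm).2] at hd
        have h1 : k * ((r d * (cos (θ d) + W d * sin (θ d)) : ℝ) : ℂ) = 0 := by
          rw [← hbc d]
          linear_combination hd
        refine (mul_eq_zero.1 h1).resolve_right ?_
        exact Complex.ofReal_ne_zero.2 (mul_ne_zero (hr d).ne' hend)
      rw [Lp.eq_zero_iff_ae_eq_zero]
      filter_upwards [hfu, ae_restrict_mem measurableSet_Ioo] with x hx hm
      rw [hx, (hk x (Ioo_subset_Icc_self hm)).1, hk0, zero_mul]
      rfl
    rw [hbot]
    exact ⟨inferInstance, fun h => absurd h hend, fun _ => finrank_bot ℂ _⟩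

theorem IsRegularization.isEigenvalueList (hR : IsRegularization a V A W c d) (hcd : c < d)
    {l : ℕ → ℝ} (hl : IsSpectralSequence A W c d (neumannAngle W c) (neumannAngle W d) l) :
    IsEigenvalueList (neumannOperator a V c d) l := by
  refine ⟨hl.1.monotone, fun z => ?_⟩
  by_cases hz : z.im = 0
  · obtain ⟨lam, rfl⟩ : ∃ lam : ℝ, (lam : ℂ) = z := ⟨z.re, Complex.ext (by simp) (by simp [hz])⟩
    obtain ⟨θ, hθ0, hθ⟩ := exists_isPruferAngle hR.continuous_left hR.left_pos hR.continuous_right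
      lam hcd.le (neumannAngle W c)
    obtain ⟨h1, h2, h3⟩ := hR.finrank_eigenspace hcd hθ0 hθ
    refine ⟨h1, ?_⟩
    simp only [Complex.ofReal_inj]
    by_cases hend : sin (θ d - neumannAngle W d) = 0
    · rw [h2 hend, Nat.cast_one]
      obtain ⟨n, hn⟩ := sin_eq_zero_iff.1 hend
      have hpos := hθ.pos hR.continuous_left hR.left_pos hR.continuous_right
        (by rw [hθ0]; exact (neumannAngle_mem W c).1) d ⟨hcd.le, le_rfl⟩
      -- A negative branch would put `θ d` at or below `κ - π < 0`, against positivity; no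
      -- eigenvalue precedes `l 0`.
      have hn0 : 0 ≤ n := by
        by_contra! h
        have h4 : (n : ℝ) ≤ -1 := by exact_mod_cast Int.le_sub_one_of_lt h
        have h5 := mul_le_mul_of_nonneg_right h4 pi_pos.le
        linarith [(neumannAngle_mem W d).2]
      lift n to ℕ using hn0
      have h4 : lam = l n := (hl.2 _ _ hθ0 hθ n).2.1 (by push_cast at hn; linarith)
      rw [encard_eq_one]
      exact ⟨n, by ext i; simp [h4, hl.1.injective.eq_iff]⟩
    · rw [h3 hend, Nat.cast_zero, encard_eq_zero, eq_empty_iff_forall_notMem]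
      intro i hi
      apply hend
      have h4 := (hl.2 _ _ hθ0 hθ i).2.2 (Eq.symm hi)
      rw [h4, add_sub_cancel_left, sin_nat_mul_pi]
  · rw [hR.eigenspace_eq_bot_of_im_ne_zero hcd hz]
    refine ⟨inferInstance, ?_⟩
    rw [finrank_bot, Nat.cast_zero, encard_eq_zero, eq_empty_iff_forall_notMem]
    intro i hi
    have hi' : (l i : ℂ) = z := hi
    exact hz (by rw [← hi', Complex.ofReal_im])

/-- The Prüfer angle detects nonvanishing of the derivative of an eigenfunction. -/
theorem IsRegularization.sin_ne_zero_of_deriv_ne_zero (hR : IsRegularization a V A W c d)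
    (hcd : c < d) {lam : ℝ} {f : L2 c d}
    (hf : f ∈ eigenspace (neumannOperator a V c d) lam) {v : ℝ → ℂ}
    (hv : ContinuousOn v (Icc c d)) (hfv : f =ᵐ[volume.restrict (Ioo c d)] v) {x : ℝ}
    (hx : x ∈ Ioo c d) (hvx : deriv v x ≠ 0) {θ : ℝ → ℝ} (hθ0 : θ c = neumannAngle W c)
    (hθ : IsPruferAngle A W lam c d θ) : sin (θ x - neumannAngle W x) ≠ 0 := by
  obtain ⟨r, hr, hs⟩ := hθ.exists_isQuasiSolution hR.continuous_left hR.continuous_right hcd.le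
  obtain ⟨u, q, hs', hc, hd, hfu⟩ := (hR.mem_eigenspace_iff hcd _ f).1 hf
  obtain ⟨k, hk⟩ := hs'.exists_eq_mul hR.continuous_left hR.continuous_right hc hr hθ0 hs
  have huv : EqOn v u (Ioo c d) := Measure.eqOn_open_of_ae_eq (hfv.symm.trans hfu) isOpen_Ioo
    (hv.mono Ioo_subset_Icc_self) (hs'.continuousOn_left.mono Ioo_subset_Icc_self)
  have hx' := Ioo_subset_Icc_self hx
  have hder : deriv v x = A x * (q x + W x * u x) := by
    rw [(huv.eventuallyEq_of_mem (isOpen_Ioo.mem_nhds hx)).deriv_eq]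
    exact ((hs' x hx').1.hasDerivAt (Icc_mem_nhds hx.1 hx.2)).deriv
  rw [Ne, ← cos_add_mul_sin_eq_zero_iff]
  intro h0
  apply hvx
  rw [hder, (hk x hx').1, (hk x hx').2]
  have h1 : (cos (θ x) : ℂ) + W x * sin (θ x) = 0 := by exact_mod_cast h0
  push_cast at h1 ⊢
  linear_combination (A x * k * r x : ℂ) * h1

end Spectrum

/-! ### Assembly -/

theorem theorem1 (α γ β : ℝ) (hαγ : α < γ) (hγβ : γ < β) (a V : ℝ → ℝ)
    (ha : ContDiffOn ℝ 1 a (Icc α β)) (ha_pos : ∀ x ∈ Icc α β, 0 < a x)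
    (hV : MemLp V ⊤ (volume.restrict (Ioo α β))) :
    (∃ l m σ ν : ℕ → ℝ,
      IsEigenvalueList (neumannOperator a V α γ) l ∧
      IsEigenvalueList (neumannOperator a V γ β) m ∧
      IsMergedList l m σ ∧
      IsEigenvalueList (neumannOperator a V α β) ν) ∧
    ∀ l m σ ν : ℕ → ℝ,
      IsEigenvalueList (neumannOperator a V α γ) l →
      IsEigenvalueList (neumannOperator a V γ β) m →
      IsMergedList l m σ →
      IsEigenvalueList (neumannOperator a V α β) ν →
      ∀ i : ℕ,
        (σ i ≤ ν i ∧ ν i ≤ σ (i + 1)) ∧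
        ∀ f ∈ eigenspace (neumannOperator a V α β) (ν i),
          f ≠ 0 →
          ∀ u : ℝ → ℂ, ContDiffOn ℝ 1 u (Icc α β) →
            (f : ℝ → ℂ) =ᵐ[volume.restrict (Ioo α β)] u →
            deriv u γ ≠ 0 → σ i < ν i ∧ ν i < σ (i + 1) := by
  have hαβ := hαγ.trans hγβ
  obtain ⟨A, W, hR⟩ := exists_isRegularization hαβ ha ha_pos hV
  have hR1 := hR.mono le_rfl hαγ.le hγβ.le
  have hR2 := hR.mono hαγ.le hγβ.le le_rfl
  have hA := hR.continuous_left
  have hA0 := hR.left_pos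
  have hW := hR.continuous_right
  have hκ := neumannAngle_mem W
  obtain ⟨l₀, hl⟩ := exists_spectral_sequence hA hA0 hW hαγ (hκ α) (hκ γ)
  obtain ⟨m₀, hm⟩ := exists_spectral_sequence hA hA0 hW hγβ (hκ γ) (hκ β)
  obtain ⟨ν₀, hν⟩ := exists_spectral_sequence hA hA0 hW hαβ (hκ α) (hκ β)
  have hL := hR1.isEigenvalueList hαγ hl
  have hM := hR2.isEigenvalueList hγβ hm
  have hN := hR.isEigenvalueList hαβ hν
  refine ⟨?_, fun l m σ ν hl' hm' hσ hν' i => ?_⟩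
  · obtain ⟨σ, hσ⟩ := exists_isMergedList (hl.finite_setOf_le hA hA0 hW hαγ)
      (hm.finite_setOf_le hA hA0 hW hγβ)
    exact ⟨l₀, m₀, σ, ν₀, hL, hM, hσ, hN⟩
  -- Eigenvalue lists are unique, so arbitrary ones may be replaced by the spectral sequences.
  obtain rfl := hl'.eq_of_strictMono hL hl.1
  obtain rfl := hm'.eq_of_strictMono hM hm.1
  obtain rfl := hν'.eq_of_strictMono hN hν.1
  have hle : σ i ≤ ν i ∧ ν i ≤ σ (i + 1) := by
    obtain ⟨k, k', hk, h1, h2⟩ := hl.exists_add_eq_forall_le hA hA0 hW hαγ hγβ hm hν i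
    obtain ⟨n, n', hn, h3, h4⟩ :=
      hl.exists_add_eq_forall_ge hA hA0 hW hαγ hγβ (hκ α) (hκ γ) (hκ β) hm hν i
    exact ⟨hσ.le_of_lt h1 h2 (by omega), hσ.le_of_le h3 h4 (by omega)⟩
  refine ⟨hle, fun f hf _ u hu hfu hder => ?_⟩
  obtain ⟨θ, hθ0, hθ⟩ := exists_isPruferAngle hA hA0 hW (ν i) hαβ.le (neumannAngle W α)
  have hsin := hR.sin_ne_zero_of_deriv_ne_zero hαβ hf hu.continuousOn hfu ⟨hαγ, hγβ⟩ hder hθ0 hθ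
  have hne : ∀ j, ν i ≠ σ j := by
    obtain ⟨_, e, he⟩ := hσ
    intro j
    rw [he]
    rcases e j with s | s
    · exact (hl.ne_of_sin_ne_zero hA hA0 hW hαγ hγβ hm hν i hθ0 hθ hsin s).1
    · exact (hl.ne_of_sin_ne_zero hA hA0 hW hαγ hγβ hm hν i hθ0 hθ hsin s).2
  exact ⟨lt_of_le_of_ne hle.1 (hne i).symm, lt_of_le_of_ne hle.2 (hne (i + 1))⟩
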